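/- Let $\Omega\subset\mathbb R^2$ be open and bounded with Lipschitz boundary, let $d\in\mathbb N$, let $g_1,\dots,g_d\in H^{1/2}(\partial\Omega)$ (the space of traces on $\partial\Omega$ of functions in $H^1(\Omega)$), and let $\tau_{i,j}>0$ $(1\le i,j\le d)$ be noise scales. Let $$\mathbb S=\{\sigma\in L^\infty(\Omega):\ 0<\sigma_{\min}<\sigma<\sigma_{\max}<\infty \text{ a.e. for some constants } \sigma_{\min},\sigma_{\max}\},$$ with the $L^\infty$ topology and its Borel $\sigma$-algebra. For $\sigma\in\mathbb S$ let $u_i\in H^1(\Omega)$ be the weak solution of $\nabla\cdot(\sigma\nabla u_i)=0$ in $\Omega$, $u_i=g_i$ on $\partial\Omega$, and put $h_{i,j}(\sigma)=\sigma\nabla u_i\cdot\nabla u_j$. For data $y=(y_{i,j})_{i,j=1}^d$ in $L^1(\Omega)$ define the negative log-likelihood and the likelihood (up to a constant factor) by $$\Phi(y,\sigma)=\sum_{i,j=1}^d\frac{\|h_{i,j}(\sigma)-y_{i,j}\|_{L^1(\Omega)}}{\tau_{i,j}},\qquad L(y;\sigma)=e^{-\Phi(y,\sigma)} .$$ Let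 $\mu=\mathcal N(m,\mathcal C)$ be a Gaussian measure on a real Hilbert space $\mathbb X$ of (a.e. classes of) measurable real functions on $\Omega$, and let $F$ be one of the maps $F_1(t)=e^t$, $F_2(t)=\sigma^-+(\sigma^+-\sigma^-)\mathbf 1_{[0,\infty)}(t)$, $F_3(t)=\sigma^-+(\sigma^+-\sigma^-)/(1+e^{-\alpha t})$, where $\sigma^\pm>0$ and $\alpha>0$. The prior on conductivities is the law of $\sigma=F\circ X$ with $X\sim\mu$, and we assume that $F\circ X\in\mathbb S$ almost surely. Then: (0) for every $\sigma\in\mathbb S$ and every $i$ the weak solution $u_i$ exists and is unique, and $h_{i,j}(\sigma)\in L^1(\Omega)$ for all $i,j$, so that $\Phi$ is well defined; (1) for every fixed $y$ in $L^1(\Omega)$ the likelihood $L(y;\cdot):\mathbb S\to\mathbb R$ is Borel measurable; (2) for every fixed $y$ in $L^1(\Omega)$ the function $\Phi(y,\cdot):\mathbb S\to\mathbb R$ is almost surely continuous, i.e. for $\mu$-almost every $x\in\mathbb X$ it is continuous at $\sigma=F\circ x$; moreover, for all $0<\sigma_{\min}<\sigma_{\max}$ there is a constant $C$, independent of $y$,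 with $$|\Phi(y,\sigma_1)-\Phi(y,\sigma_2)|\le C\,\|\sigma_1-\sigma_2\|_{L^\infty(\Omega)}$$ for all $y$ and all $\sigma_1,\sigma_2\in\mathbb S$ with $\sigma_{\min}<\sigma_1,\sigma_2<\sigma_{\max}$ a.e.; (3) for all $r>0$ and $\sigma_{\max}>0$ there is a constant $C=C(r,\sigma_{\max})$ such that for every $\sigma\in\mathbb S$ with $\sigma<\sigma_{\max}$ a.e. and all data $y^1,y^2$ with $\max\{\|y^1_{i,j}\|_{L^1},\|y^2_{i,j}\|_{L^1}\}<r$ for all $i,j$, $$|\Phi(y^1,\sigma)-\Phi(y^2,\sigma)|\le C\sum_{i,j=1}^d\|y^1_{i,j}-y^2_{i,j}\|_{L^1(\Omega)} .$$ -/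

import Mathlib

open MeasureTheory ProbabilityTheory Filter Topology
open scoped ENNReal NNReal MeasureTheory

noncomputable section

namespace AET

/-- The Euclidean plane, with its Euclidean norm. -/
abbrev Plane : Type := EuclideanSpace ℝ (Fin 2)

/-! ### The domain -/

/-- `Ω` has Lipschitz boundary: near each boundary point, after an orthogonal change of
coordinates, `Ω` is the region strictly above the graph of a Lipschitz function. -/
def HasLipschitzBoundary (Ω : Set Plane) : Prop :=
  ∀ p ∈ frontier Ω, ∃ (L : Plane ≃ₗᵢ[ℝ] Plane) (K : ℝ≥0) (γ : ℝ → ℝ) (U : Set Plane),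
    LipschitzWith K γ ∧ IsOpen U ∧ p ∈ U ∧ ∀ x ∈ U, (x ∈ Ω ↔ γ (L x 0) < L x 1)

/-- An open, bounded subset of the plane with Lipschitz boundary. -/
structure IsLipschitzDomain (Ω : Set Plane) : Prop where
  isOpen : IsOpen Ω
  isBounded : Bornology.IsBounded Ω
  lipschitz : HasLipschitzBoundary Ω

/-- Lebesgue measure on `Ω`. -/
abbrev vol (Ω : Set Plane) : Measure Plane := volume.restrict Ω

/-- Arc length on `∂Ω` (one-dimensional Hausdorff measure). -/
abbrev arcLength (Ω : Set Plane) : Measure Plane := (μH[1]).restrict (frontier Ω)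

/-! ### Sobolev functions and traces -/

/-- `G` is the weak gradient of `u` in `Ω`: `∫_Ω u ∇φ = - ∫_Ω φ G` for all `φ ∈ C_c^∞(Ω)`. -/
def HasWeakGradient (Ω : Set Plane) (u : Plane → ℝ) (G : Plane → Plane) : Prop :=
  ∀ φ : Plane → ℝ, ContDiff ℝ (⊤ : ℕ∞) φ → HasCompactSupport φ → tsupport φ ⊆ Ω →
    ∫ x in Ω, u x • gradient φ x = -∫ x in Ω, φ x • G x

/-- `u ∈ H¹(Ω)`, with weak gradient `G`. -/
structure MemH1 (Ω : Set Plane) (u : Plane → ℝ) (G : Plane → Plane) : Prop where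
  memLp : MemLp u 2 (vol Ω)
  memLp_grad : MemLp G 2 (vol Ω)
  weakGradient : HasWeakGradient Ω u G

/-- `g ∈ L²(∂Ω)` is the trace on `∂Ω` of the function `u ∈ H¹(Ω)` with weak gradient `G`.
The trace operator is the continuous extension of the restriction `φ ↦ φ|_∂Ω` of smooth
functions, from `H¹(Ω)` to `L²(∂Ω)`; so `g` is the trace of `u` when some sequence of smooth
functions tends to `u` in `H¹(Ω)` while its restrictions to `∂Ω` tend to `g` in `L²(∂Ω)`. -/
structure HasTrace (Ω : Set Plane) (u : Plane → ℝ) (G : Plane → Plane) (g : Plane → ℝ) :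
    Prop where
  memH1 : MemH1 Ω u G
  memLp_boundary : MemLp g 2 (arcLength Ω)
  approx : ∃ φ : ℕ → Plane → ℝ, (∀ n, ContDiff ℝ (⊤ : ℕ∞) (φ n)) ∧
    Tendsto (fun n => eLpNorm (fun x => φ n x - u x) 2 (vol Ω)) atTop (𝓝 0) ∧
    Tendsto (fun n => eLpNorm (fun x => gradient (φ n) x - G x) 2 (vol Ω)) atTop (𝓝 0) ∧
    Tendsto (fun n => eLpNorm (fun x => φ n x - g x) 2 (arcLength Ω)) atTop (𝓝 0)

/-- `g ∈ H^{1/2}(∂Ω)`, the space of traces of functions in `H¹(Ω)`. -/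
def MemHHalf (Ω : Set Plane) (g : Plane → ℝ) : Prop :=
  ∃ (u : Plane → ℝ) (G : Plane → Plane), HasTrace Ω u G g

/-- `u`, with weak gradient `G`, is a weak solution in `H¹(Ω)` of `div (σ ∇u) = 0` in `Ω`,
`u = g` on `∂Ω`; the test functions are the functions in `H¹(Ω)` with vanishing trace. -/
structure IsWeakSolution (Ω : Set Plane) (σ g : Plane → ℝ) (u : Plane → ℝ)
    (G : Plane → Plane) : Prop where
  trace : HasTrace Ω u G g
  weak : ∀ (w : Plane → ℝ) (W : Plane → Plane), HasTrace Ω w W (fun _ => 0) →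
    ∫ x in Ω, σ x * inner ℝ (G x) (W x) = 0

/-! ### Conductivities, power densities, likelihood -/

/-- The conductivities: elements `σ` of `L^∞(Ω)` with `0 < σ_min < σ < σ_max < ∞` almost
everywhere, for some constants. It carries the `L^∞` topology. -/
abbrev Conductivity (Ω : Set Plane) : Type :=
  {σ : Lp ℝ ∞ (vol Ω) // ∃ a b : ℝ, 0 < a ∧ ∀ᵐ ξ ∂(vol Ω), a < σ ξ ∧ σ ξ < b}

/-- The conductivities with the given bounds, `a < σ < b` almost everywhere. -/
def boundedBy (Ω : Set Plane) (a b : ℝ) : Set (Conductivity Ω) :=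
  {σ | ∀ᵐ ξ ∂(vol Ω), a < σ.1 ξ ∧ σ.1 ξ < b}

/-- The gradient `∇u` of the potential `u` with conductivity `σ` and boundary value `g`. -/
def gradPotential (Ω : Set Plane) (σ g : Plane → ℝ) : Plane → Plane :=
  Classical.epsilon fun G => ∃ u, IsWeakSolution Ω σ g u G

/-- The power density `h_{i,j}(σ) = σ ∇u_i · ∇u_j`. -/
def powerDensity {Ω : Set Plane} {d : ℕ} (g : Fin d → Plane → ℝ) (σ : Conductivity Ω)
    (i j : Fin d) : Plane → ℝ :=
  fun ξ => σ.1 ξ * inner ℝ (gradPotential Ω σ.1 (g i) ξ) (gradPotential Ω σ.1 (g j) ξ)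

/-- A collection of measurements `y_{i,j} ∈ L¹(Ω)`. -/
abbrev Data (Ω : Set Plane) (d : ℕ) : Type := Fin d → Fin d → Lp ℝ 1 (vol Ω)

/-- The negative log-likelihood `Φ(y; σ) = ∑_{i,j} ‖h_{i,j}(σ) - y_{i,j}‖_{L¹} / τ_{i,j}`. -/
def negLogLikelihood {Ω : Set Plane} {d : ℕ} (g : Fin d → Plane → ℝ) (τ : Fin d → Fin d → ℝ)
    (y : Data Ω d) (σ : Conductivity Ω) : ℝ :=
  ∑ i, ∑ j, (∫ ξ in Ω, |powerDensity g σ i j ξ - y i j ξ|) / τ i j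

/-- The likelihood `L(y; σ) = exp (-Φ(y; σ))`, up to a constant factor. -/
def likelihood {Ω : Set Plane} {d : ℕ} (g : Fin d → Plane → ℝ) (τ : Fin d → Fin d → ℝ)
    (y : Data Ω d) (σ : Conductivity Ω) : ℝ :=
  Real.exp (-negLogLikelihood g τ y σ)

/-! ### The prior maps -/

/-- `F₁(t) = exp t`. -/
def expMap (t : ℝ) : ℝ := Real.exp t

/-- `F₂(t) = σ⁻ + (σ⁺ - σ⁻) H(t)`, where `H` is the characteristic function of `[0, ∞)`. -/
def twoLevelMap (sp sm t : ℝ) : ℝ := sm + (sp - sm) * (Set.Ici (0 : ℝ)).indicator 1 t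

/-- `F₃(t) = σ⁻ + (σ⁺ - σ⁻) / (1 + exp (-α t))`. -/
def sigmoidMap (sp sm α t : ℝ) : ℝ := sm + (sp - sm) * (1 / (1 + Real.exp (-α * t)))

/-- `F` is one of the three maps that turn a Gaussian random field into a conductivity. -/
def IsPriorMap (F : ℝ → ℝ) : Prop :=
  F = expMap ∨ (∃ sp sm : ℝ, 0 < sp ∧ 0 < sm ∧ F = twoLevelMap sp sm) ∨
    ∃ sp sm α : ℝ, 0 < sp ∧ 0 < sm ∧ 0 < α ∧ F = sigmoidMap sp sm α

end AET

end

/-! Everything rests on $\Phi(y,\cdot)$ being locally Lipschitz in $L^\infty$ at every conductivity.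
This gives continuity at every prior sample, hence almost surely, and it gives Borel measurability
of $e^{-\Phi}$.

The potentials are studied through their gradients in $L^2$. The gradients of functions with zero
trace form a subspace $N$, and all candidate gradients for the boundary value $g$ lie in one affine
space $U+N$, with $U$ the gradient of a fixed extension of $g$. Lax–Milgram on $N$ needs $N$ to be
closed, which follows from the Poincaré inequality for zero trace (`isClosed_zeroTraceGradients`).
That inequality is first proved for smooth functions with a boundary term: integrate along
horizontal rays up to the point where they leave $\Omega$. Projection to the vertical axis is
1-Lipschitz, so the law of the exit point is dominated by arc length (`map_exitPoint_le`).

For $a<\sigma<b$, testing the equation with differences in $N$ gives $\|\nabla u\|\le (b/a)\|U\|$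
and $\|\nabla u_1-\nabla u_2\|\le (b/a^2)\|U\|\,\|\sigma_1-\sigma_2\|_\infty$. The density
$\sigma\nabla u_i\cdot\nabla u_j$ is a product of three such factors, hence Lipschitz into $L^1$
with a constant depending only on $a$, $b$ and the extensions. The reverse triangle inequality
transfers this to $\Phi$ and also gives the bound in the data. -/

noncomputable section

namespace AET

section Poincare

/-! ### The Poincaré inequality with a boundary term -/

/-- The first coordinate vector of the plane. -/
def e₁ : Plane := EuclideanSpace.single 0 1

@[simp] lemma norm_e₁ : ‖e₁‖ = 1 := by simp [e₁]

/-- The time after which the horizontal ray from `x` to the left leaves `Ω`. -/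
def exitTime (Ω : Set Plane) (x : Plane) : ℝ := sInf {s : ℝ | 0 ≤ s ∧ x - s • e₁ ∉ Ω}

/-- The point where the horizontal ray from `x` to the left leaves `Ω`. -/
def exitPoint (Ω : Set Plane) (x : Plane) : Plane := x - exitTime Ω x • e₁

lemma bddBelow_exitTimes (Ω : Set Plane) (x : Plane) :
    BddBelow {s : ℝ | 0 ≤ s ∧ x - s • e₁ ∉ Ω} := ⟨0, fun _ h => h.1⟩

lemma exitTime_nonneg (Ω : Set Plane) (x : Plane) : 0 ≤ exitTime Ω x :=
  Real.sInf_nonneg fun _ h => h.1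

lemma mem_of_lt_exitTime {Ω : Set Plane} {x : Plane} {s : ℝ} (hs : 0 ≤ s)
    (h : s < exitTime Ω x) : x - s • e₁ ∈ Ω := by
  by_contra hn
  exact absurd (csInf_le (bddBelow_exitTimes Ω x) ⟨hs, hn⟩) (not_le.2 h)

lemma abs_coord_le_norm (x : Plane) (i : Fin 2) : |x i| ≤ ‖x‖ := by
  simpa using PiLp.norm_apply_le x i

variable {Ω : Set Plane}

/-- Points of the ball have first coordinate in $(-R,R)$, so no two of them differ there by $2R$. -/
lemma sub_smul_notMem {R : ℝ} (hR : Ω ⊆ Metric.ball 0 R) {x : Plane} (hx : x ∈ Ω) :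
    x - (2 * R) • e₁ ∉ Ω := by
  intro h
  have h1 := (abs_coord_le_norm x 0).trans_lt (by simpa using hR hx)
  have h2 := (abs_coord_le_norm _ 0).trans_lt (mem_ball_zero_iff.1 (hR h))
  simp [e₁, abs_lt] at h1 h2
  linarith

lemma exitTime_le {R : ℝ} (hR : Ω ⊆ Metric.ball 0 R) (x : Plane) (hx : x ∈ Ω) :
    exitTime Ω x ≤ 2 * R := by
  have : 0 < R := by
    have := mem_ball_zero_iff.1 (hR hx)
    exact (norm_nonneg _).trans_lt this
  exact csInf_le (bddBelow_exitTimes Ω x) ⟨by positivity, sub_smul_notMem hR hx⟩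

lemma exitPoint_notMem (ho : IsOpen Ω) (hb : Bornology.IsBounded Ω) (x : Plane) :
    exitPoint Ω x ∉ Ω := by
  obtain ⟨R, hR⟩ := hb.subset_ball 0
  have hcl : IsClosed {s : ℝ | 0 ≤ s ∧ x - s • e₁ ∉ Ω} := by
    refine isClosed_Ici.inter (ho.isClosed_compl.preimage (f := fun s : ℝ => x - s • e₁) ?_)
    fun_prop
  have hne : {s : ℝ | 0 ≤ s ∧ x - s • e₁ ∉ Ω}.Nonempty := by
    by_cases hx : x ∈ Ω
    · have : 0 < R := (norm_nonneg _).trans_lt (mem_ball_zero_iff.1 (hR hx))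
      exact ⟨2 * R, by positivity, sub_smul_notMem hR hx⟩
    · exact ⟨0, le_rfl, by simpa using hx⟩
  exact (hcl.csInf_mem hne (bddBelow_exitTimes Ω x)).2

lemma exitTime_pos (ho : IsOpen Ω) (hb : Bornology.IsBounded Ω) {x : Plane} (hx : x ∈ Ω) :
    0 < exitTime Ω x := by
  refine (exitTime_nonneg Ω x).lt_of_ne fun h => exitPoint_notMem ho hb x ?_
  simpa [exitPoint, ← h] using hx

lemma exitPoint_mem_frontier (ho : IsOpen Ω) (hb : Bornology.IsBounded Ω) {x : Plane}
    (hx : x ∈ Ω) : exitPoint Ω x ∈ frontier Ω := by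
  rw [ho.frontier_eq]
  refine ⟨?_, exitPoint_notMem ho hb x⟩
  have hpos := exitTime_pos ho hb hx
  have hc : Continuous fun s : ℝ => x - s • e₁ := by fun_prop
  refine mem_closure_of_tendsto (f := fun s : ℝ => x - s • e₁) (b := 𝓝[<] exitTime Ω x)
    (hc.continuousAt.tendsto.mono_left nhdsWithin_le_nhds) ?_
  filter_upwards [Ioo_mem_nhdsLT hpos] with s hs
  exact mem_of_lt_exitTime hs.1.le hs.2

/-- The exit time is lower semicontinuous: if it exceeds $c$ at $x$, the compact segment of length
$c$ to the left of $x$ lies in the open set $\Omega$, and so do the translated segments from nearby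
points. -/
lemma measurable_exitTime (ho : IsOpen Ω) (hb : Bornology.IsBounded Ω) :
    Measurable (exitTime Ω) := by
  refine LowerSemicontinuous.measurable fun x c hc => ?_
  rcases lt_or_ge c 0 with h | h
  · exact Eventually.of_forall fun y => h.trans_le (exitTime_nonneg Ω y)
  have hK : ∀ᶠ y in 𝓝 x, ∀ s ∈ Set.Icc 0 c, y - s • e₁ ∈ Ω := by
    refine isCompact_Icc.eventually_forall_of_forall_eventually fun s hs => ?_
    have hcont : Continuous fun z : Plane × ℝ => z.1 - z.2 • e₁ := by fun_prop
    exact hcont.continuousAt.eventually_mem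
      (ho.mem_nhds (mem_of_lt_exitTime hs.1 (hs.2.trans_lt hc)))
  filter_upwards [hK] with y hy
  by_contra hle
  exact exitPoint_notMem ho hb y (hy _ ⟨exitTime_nonneg Ω y, not_lt.1 hle⟩)

lemma measurable_exitPoint (ho : IsOpen Ω) (hb : Bornology.IsBounded Ω) :
    Measurable (exitPoint Ω) :=
  measurable_id.sub ((measurable_exitTime ho hb).smul_const e₁)

/-- No measurability of $B$ is required, since $B$ will be the projection of a piece of the
boundary. -/
lemma volume_strip_le (R : ℝ) (B : Set ℝ) :
    volume {x : Plane | x 0 ∈ Set.Icc (-R) R ∧ x 1 ∈ B} ≤ ENNReal.ofReal (2 * R) * volume B := by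
  have h := (EuclideanSpace.volume_preserving_symm_measurableEquiv_toLp (Fin 2)).measure_preimage_equiv
    (Set.univ.pi ![Set.Icc (-R) R, B])
  have h2 : {x : Plane | x 0 ∈ Set.Icc (-R) R ∧ x 1 ∈ B} =
      (MeasurableEquiv.toLp 2 (Fin 2 → ℝ)).symm ⁻¹' (Set.univ.pi ![Set.Icc (-R) R, B]) := by
    ext x
    simp [Set.mem_pi, Fin.forall_fin_two]
  rw [h2, h, volume_pi, Measure.pi_pi]
  simp [Fin.prod_univ_two, two_mul]

/-- Moving horizontally keeps the second coordinate, so the points that exit through $E$ lie in a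
strip of width $2R$ over the vertical projection of $E\cap\partial\Omega$. A 1-Lipschitz projection
does not increase one-dimensional Hausdorff measure. -/
lemma map_exitPoint_le (ho : IsOpen Ω) (hb : Bornology.IsBounded Ω) {R : ℝ}
    (hR : Ω ⊆ Metric.ball 0 R) :
    (vol Ω).map (exitPoint Ω) ≤ ENNReal.ofReal (2 * R) • arcLength Ω := by
  refine Measure.le_iff.2 fun E hE => ?_
  have hm := measurable_exitPoint ho hb
  rw [Measure.map_apply hm hE, Measure.restrict_apply (hm hE), Measure.smul_apply,
    Measure.restrict_apply hE, smul_eq_mul]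
  have hproj : LipschitzWith 1 fun x : Plane => x 1 :=
    LipschitzWith.of_dist_le_mul fun x y => by
      simpa [dist_eq_norm] using abs_coord_le_norm (x - y) 1
  have hsub : exitPoint Ω ⁻¹' E ∩ Ω ⊆ {x : Plane | x 0 ∈ Set.Icc (-R) R ∧
      x 1 ∈ (fun x : Plane => x 1) '' (E ∩ frontier Ω)} := by
    rintro x ⟨hxE, hx⟩
    have h0 := (abs_coord_le_norm x 0).trans (mem_ball_zero_iff.1 (hR hx)).le
    exact ⟨abs_le.1 h0, exitPoint Ω x, ⟨hxE, exitPoint_mem_frontier ho hb hx⟩,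
      by simp [exitPoint, e₁]⟩
  refine (measure_mono hsub).trans ((volume_strip_le R _).trans ?_)
  gcongr
  rw [← hausdorffMeasure_real]
  simpa using hproj.hausdorffMeasure_image_le zero_le_one (E ∩ frontier Ω)

lemma hasDerivAt_comp_line {φ : Plane → ℝ} (hφ : ContDiff ℝ (⊤ : ℕ∞) φ) (x v : Plane) (s : ℝ) :
    HasDerivAt (fun s : ℝ => φ (x - s • v)) (-inner ℝ (gradient φ (x - s • v)) v) s := by
  have h1 : HasDerivAt (fun s : ℝ => x - s • v) (-v) s := by
    simpa using ((hasDerivAt_id s).smul_const v).const_sub x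
  have h2 := ((hφ.differentiable (by simp)) (x - s • v)).hasGradientAt.hasFDerivAt
  simpa [Function.comp_def] using h2.comp_hasDerivAt s h1

lemma continuous_gradient {φ : Plane → ℝ} (hφ : ContDiff ℝ (⊤ : ℕ∞) φ) :
    Continuous (gradient φ) :=
  (InnerProductSpace.toDual ℝ Plane).symm.continuous.comp (hφ.continuous_fderiv (by simp))

/-- Fundamental theorem of calculus along the ray. The indicator and the fixed range $(0,2R]$ remove
the exit time from the integral, which prepares for Tonelli and translation invariance. -/
lemma enorm_le_exitPoint_add {R : ℝ}
    (hR : Ω ⊆ Metric.ball 0 R) {φ : Plane → ℝ} (hφ : ContDiff ℝ (⊤ : ℕ∞) φ) {x : Plane}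
    (hx : x ∈ Ω) :
    ‖φ x‖ₑ ≤ ‖φ (exitPoint Ω x)‖ₑ +
      ∫⁻ s in Set.Ioc 0 (2 * R), Ω.indicator (fun z => ‖gradient φ z‖ₑ) (x - s • e₁) := by
  have hτ := exitTime_nonneg Ω x
  have hcl : Continuous fun s : ℝ => x - s • e₁ := by fun_prop
  have hcont : Continuous fun s : ℝ => -inner ℝ (gradient φ (x - s • e₁)) e₁ :=
    (((continuous_gradient hφ).comp hcl).inner continuous_const).neg
  have hftc := intervalIntegral.integral_eq_sub_of_hasDerivAt (a := 0) (b := exitTime Ω x)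
    (fun s _ => hasDerivAt_comp_line hφ x e₁ s) (hcont.intervalIntegrable _ _)
  have heq : φ x = φ (exitPoint Ω x) -
      ∫ s in (0 : ℝ)..exitTime Ω x, -inner ℝ (gradient φ (x - s • e₁)) e₁ := by
    rw [hftc]; simp [exitPoint]
  calc ‖φ x‖ₑ ≤ ‖φ (exitPoint Ω x)‖ₑ +
        ‖∫ s in (0 : ℝ)..exitTime Ω x, -inner ℝ (gradient φ (x - s • e₁)) e₁‖ₑ := by
        conv_lhs => rw [heq]
        exact enorm_sub_le
    _ ≤ _ := by
        gcongr
        rw [intervalIntegral.integral_of_le hτ]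
        refine (enorm_integral_le_lintegral_enorm _).trans ?_
        -- The right endpoint is dropped because the exit point is outside $\Omega$, where the
        -- indicator vanishes.
        rw [← restrict_Ioo_eq_restrict_Ioc]
        have hle : ∀ s ∈ Set.Ioo 0 (exitTime Ω x),
            ‖-inner ℝ (gradient φ (x - s • e₁)) e₁‖ₑ ≤
              Ω.indicator (fun z => ‖gradient φ z‖ₑ) (x - s • e₁) := by
          intro s hs
          rw [Set.indicator_of_mem (mem_of_lt_exitTime hs.1.le hs.2), enorm_neg]
          rw [enorm_le_iff_norm_le]
          simpa using norm_inner_le_norm (𝕜 := ℝ) (gradient φ (x - s • e₁)) e₁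
        refine (setLIntegral_mono' measurableSet_Ioo hle).trans
          (lintegral_mono_set fun s hs => ⟨hs.1, hs.2.le.trans (exitTime_le hR x hx)⟩)

lemma sq_lintegral_le {α : Type*} [MeasurableSpace α] (μ : Measure α) {f : α → ℝ≥0∞}
    (hf : AEMeasurable f μ) :
    (∫⁻ a, f a ∂μ) ^ (2 : ℝ) ≤ μ Set.univ * ∫⁻ a, f a ^ (2 : ℝ) ∂μ := by
  have h := ENNReal.lintegral_mul_le_Lp_mul_Lq μ Real.HolderConjugate.two_two
    (aemeasurable_const (b := (1 : ℝ≥0∞))) hf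
  simp only [Pi.mul_apply, one_mul, ENNReal.one_rpow, lintegral_const] at h
  refine (ENNReal.rpow_le_rpow h zero_le_two).trans ?_
  rw [ENNReal.mul_rpow_of_nonneg _ _ zero_le_two, ← ENNReal.rpow_mul, ← ENNReal.rpow_mul]
  simp

/-- Cauchy–Schwarz in $s$ costs one factor $2R$. After exchanging the integrals, translation
invariance makes the inner one independent of $s$, which costs a second; the square root leaves one.
-/
lemma eLpNorm_lineIntegral_le (ho : IsOpen Ω) (R : ℝ) {f : Plane → ℝ≥0∞} (hf : Measurable f) :
    eLpNorm (fun x => ∫⁻ s in Set.Ioc 0 (2 * R), Ω.indicator f (x - s • e₁)) 2 (vol Ω) ≤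
      ENNReal.ofReal (2 * R) * eLpNorm f 2 (vol Ω) := by
  set D := ENNReal.ofReal (2 * R)
  have hF : Measurable (Ω.indicator f) := hf.indicator ho.measurableSet
  have hline : Measurable fun z : Plane × ℝ => z.1 - z.2 • e₁ := by fun_prop
  have hm : Measurable fun z : Plane × ℝ => Ω.indicator f (z.1 - z.2 • e₁) ^ (2 : ℝ) :=
    (hF.comp hline).pow_const 2
  rw [eLpNorm_eq_lintegral_rpow_enorm_toReal two_ne_zero ENNReal.ofNat_ne_top,
    eLpNorm_eq_lintegral_rpow_enorm_toReal two_ne_zero ENNReal.ofNat_ne_top]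
  simp only [enorm_eq_self, ENNReal.toReal_ofNat]
  have hkey : ∫⁻ x, (∫⁻ s in Set.Ioc 0 (2 * R), Ω.indicator f (x - s • e₁)) ^ (2 : ℝ) ∂(vol Ω) ≤
      D ^ (2 : ℝ) * ∫⁻ x, f x ^ (2 : ℝ) ∂(vol Ω) :=
    calc _ ≤ ∫⁻ x, (∫⁻ s in Set.Ioc 0 (2 * R), Ω.indicator f (x - s • e₁)) ^ (2 : ℝ) :=
          lintegral_mono' Measure.restrict_le_self le_rfl
      _ ≤ ∫⁻ x, D * ∫⁻ s in Set.Ioc 0 (2 * R), Ω.indicator f (x - s • e₁) ^ (2 : ℝ) := by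
          refine lintegral_mono fun x => ?_
          have hl : Measurable fun s : ℝ => x - s • e₁ := by fun_prop
          simpa [D] using sq_lintegral_le (volume.restrict (Set.Ioc 0 (2 * R)))
            (hF.comp hl).aemeasurable
      _ = D * ∫⁻ s in Set.Ioc 0 (2 * R), ∫⁻ x, Ω.indicator f (x - s • e₁) ^ (2 : ℝ) := by
          rw [lintegral_const_mul _ (hm.lintegral_prod_right'),
            lintegral_lintegral_swap hm.aemeasurable]
      _ = D * ∫⁻ s in Set.Ioc 0 (2 * R), ∫⁻ x, Ω.indicator f x ^ (2 : ℝ) := by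
          congr 1
          exact lintegral_congr fun s =>
            lintegral_sub_right_eq_self (fun x => Ω.indicator f x ^ (2 : ℝ)) (s • e₁)
      _ = D ^ (2 : ℝ) * ∫⁻ x, f x ^ (2 : ℝ) ∂(vol Ω) := by
          rw [← lintegral_indicator ho.measurableSet]
          have : ∀ x, Ω.indicator f x ^ (2 : ℝ) = Ω.indicator (fun x => f x ^ (2 : ℝ)) x := by
            intro x
            by_cases hx : x ∈ Ω <;> simp [hx]
          simp only [this, lintegral_const, Measure.restrict_apply_univ, Real.volume_Ioc, sub_zero]
          rw [show ENNReal.ofReal (2 * R) = D from rfl, ENNReal.rpow_two]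
          ring
  refine (ENNReal.rpow_le_rpow hkey (by norm_num)).trans_eq ?_
  rw [ENNReal.mul_rpow_of_nonneg _ _ (by norm_num), ← ENNReal.rpow_mul]
  norm_num

/-- The Poincaré inequality with a boundary term, for smooth functions on a bounded open set. -/
theorem exists_eLpNorm_le_gradient_add_boundary (ho : IsOpen Ω) (hb : Bornology.IsBounded Ω) :
    ∃ C : ℝ≥0∞, C ≠ ∞ ∧ ∀ φ : Plane → ℝ, ContDiff ℝ (⊤ : ℕ∞) φ →
      eLpNorm φ 2 (vol Ω) ≤ C * (eLpNorm (gradient φ) 2 (vol Ω) + eLpNorm φ 2 (arcLength Ω)) := by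
  obtain ⟨R, hR⟩ := hb.subset_ball 0
  set D := ENNReal.ofReal (2 * R)
  -- $D$ comes from the line integral of the gradient, $D^{1/2}$ from scaling arc length by $D$
  -- inside an $L^2$ norm.
  refine ⟨D + D ^ (1 / 2 : ℝ), by finiteness, fun φ hφ => ?_⟩
  have hgrad := continuous_gradient hφ
  have hp := measurable_exitPoint ho hb
  have hbd : eLpNorm (fun x => ‖φ (exitPoint Ω x)‖ₑ) 2 (vol Ω) ≤
      D ^ (1 / 2 : ℝ) * eLpNorm φ 2 (arcLength Ω) := by
    have h1 : eLpNorm (fun x => ‖φ (exitPoint Ω x)‖ₑ) 2 (vol Ω) =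
        eLpNorm φ 2 ((vol Ω).map (exitPoint Ω)) := by
      rw [eLpNorm_map_measure hφ.continuous.aestronglyMeasurable hp.aemeasurable]
      exact eLpNorm_enorm _
    rw [h1]
    refine (eLpNorm_mono_measure φ (map_exitPoint_le ho hb hR)).trans_eq ?_
    rw [eLpNorm_smul_measure_of_ne_top ENNReal.ofNat_ne_top]
    simp [D]
  calc eLpNorm φ 2 (vol Ω)
      ≤ eLpNorm ((fun x => ‖φ (exitPoint Ω x)‖ₑ) + fun x => ∫⁻ s in Set.Ioc 0 (2 * R),
          Ω.indicator (fun z => ‖gradient φ z‖ₑ) (x - s • e₁)) 2 (vol Ω) := by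
        refine eLpNorm_mono_enorm_ae ?_
        filter_upwards [ae_restrict_mem ho.measurableSet] with x hx
        simpa using enorm_le_exitPoint_add hR hφ hx
    _ ≤ D ^ (1 / 2 : ℝ) * eLpNorm φ 2 (arcLength Ω) + D * eLpNorm (gradient φ) 2 (vol Ω) := by
        refine (eLpNorm_add_le ?_ ?_ one_le_two).trans ?_
        · exact (hφ.continuous.measurable.comp hp).enorm.aestronglyMeasurable
        · refine Measurable.aestronglyMeasurable ?_
          have hline : Measurable fun z : Plane × ℝ => z.1 - z.2 • e₁ := by fun_prop
          exact ((hgrad.measurable.enorm.indicator ho.measurableSet).comp hline).lintegral_prod_right'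
        · refine add_le_add hbd ((eLpNorm_lineIntegral_le ho R hgrad.measurable.enorm).trans_eq ?_)
          rw [eLpNorm_enorm]
    _ ≤ _ := by
        rw [add_comm, mul_add]
        gcongr
        · exact le_self_add
        · exact le_add_self

end Poincare

section Trace

/-! ### Functions with a trace -/

/-! ### Passing to the limit in $L^2$ -/

section Convergence

variable {α E : Type*} [MeasurableSpace α] {μ : Measure α} [NormedAddCommGroup E]

lemma eventually_memLp_of_tendsto {p : ℝ≥0∞} {F : ℕ → α → E} {f : α → E}
    (hF : ∀ n, AEStronglyMeasurable (F n) μ) (hf : MemLp f p μ)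
    (h : Tendsto (fun n => eLpNorm (fun x => F n x - f x) p μ) atTop (𝓝 0)) :
    ∀ᶠ n in atTop, MemLp (F n) p μ := by
  filter_upwards [h.eventually_lt_const ENNReal.zero_lt_top] with n hn
  have h1 : MemLp (fun x => F n x - f x) p μ := ⟨(hF n).sub hf.1, hn⟩
  refine (h1.add hf).ae_eq (.of_eq ?_)
  ext x; simp

variable [NormedSpace ℝ E]

lemma tendsto_integral_smul {F : ℕ → α → ℝ} {f : α → ℝ} {g : α → E}
    (hF : ∀ n, AEStronglyMeasurable (F n) μ) (hf : MemLp f 2 μ) (hg : MemLp g 2 μ)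
    (h : Tendsto (fun n => eLpNorm (fun x => F n x - f x) 2 μ) atTop (𝓝 0)) :
    Tendsto (fun n => ∫ x, F n x • g x ∂μ) atTop (𝓝 (∫ x, f x • g x ∂μ)) := by
  refine tendsto_integral_of_L1 (fun x => f x • g x) (hf.1.smul hg.1) ?_ ?_
  · filter_upwards [eventually_memLp_of_tendsto hF hf h] with n hn
    exact memLp_one_iff_integrable.1 (hg.smul (p := 2) (q := 2) hn)
  · have hlim : Tendsto (fun n => eLpNorm (fun x => F n x - f x) 2 μ * eLpNorm g 2 μ) atTop
        (𝓝 0) := by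
      simpa using ENNReal.Tendsto.mul_const h (Or.inr hg.eLpNorm_ne_top)
    refine tendsto_of_tendsto_of_tendsto_of_le_of_le tendsto_const_nhds hlim (fun _ => zero_le)
      fun n => ?_
    have := eLpNorm_smul_le_mul_eLpNorm (p := 2) (q := 2) (r := 1) hg.1 ((hF n).sub hf.1)
    rw [eLpNorm_one_eq_lintegral_enorm] at this
    simp only [← sub_smul]
    exact this

lemma tendsto_integral_smul' {F : ℕ → α → E} {f : α → E} {g : α → ℝ}
    (hF : ∀ n, AEStronglyMeasurable (F n) μ) (hf : MemLp f 2 μ) (hg : MemLp g 2 μ)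
    (h : Tendsto (fun n => eLpNorm (fun x => F n x - f x) 2 μ) atTop (𝓝 0)) :
    Tendsto (fun n => ∫ x, g x • F n x ∂μ) atTop (𝓝 (∫ x, g x • f x ∂μ)) := by
  refine tendsto_integral_of_L1 (fun x => g x • f x) (hg.1.smul hf.1) ?_ ?_
  · filter_upwards [eventually_memLp_of_tendsto hF hf h] with n hn
    exact memLp_one_iff_integrable.1 (hn.smul (p := 2) (q := 2) hg)
  · have hlim : Tendsto (fun n => eLpNorm g 2 μ * eLpNorm (fun x => F n x - f x) 2 μ) atTop
        (𝓝 0) := by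
      simpa using ENNReal.Tendsto.const_mul h (Or.inr hg.eLpNorm_ne_top)
    refine tendsto_of_tendsto_of_tendsto_of_le_of_le tendsto_const_nhds hlim (fun _ => zero_le)
      fun n => ?_
    have := eLpNorm_smul_le_mul_eLpNorm (p := 2) (q := 2) (r := 1) ((hF n).sub hf.1) hg.1
    rw [eLpNorm_one_eq_lintegral_enorm] at this
    simp only [← smul_sub]
    exact this

lemma tendsto_eLpNorm_add_smul {F G : ℕ → α → E} {f g : α → E} (c : ℝ)
    (hF : ∀ n, AEStronglyMeasurable (F n) μ) (hG : ∀ n, AEStronglyMeasurable (G n) μ)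
    (hf : AEStronglyMeasurable f μ) (hg : AEStronglyMeasurable g μ)
    (h : Tendsto (fun n => eLpNorm (fun x => F n x - f x) 2 μ) atTop (𝓝 0))
    (h' : Tendsto (fun n => eLpNorm (fun x => G n x - g x) 2 μ) atTop (𝓝 0)) :
    Tendsto (fun n => eLpNorm (fun x => (F n x + c • G n x) - (f x + c • g x)) 2 μ) atTop
      (𝓝 0) := by
  have hlim : Tendsto (fun n => eLpNorm (fun x => F n x - f x) 2 μ +
      ‖c‖ₑ * eLpNorm (fun x => G n x - g x) 2 μ) atTop (𝓝 0) := by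
    simpa using h.add (ENNReal.Tendsto.const_mul h' (Or.inr enorm_ne_top))
  refine tendsto_of_tendsto_of_tendsto_of_le_of_le tendsto_const_nhds hlim (fun _ => zero_le)
    fun n => ?_
  have heq : (fun x => (F n x + c • G n x) - (f x + c • g x)) =
      (fun x => F n x - f x) + c • fun x => G n x - g x := by
    ext x; simp only [Pi.add_apply, Pi.smul_apply]; module
  simp only [heq]
  refine (eLpNorm_add_le ((hF n).sub hf) (((hG n).sub hg).const_smul c) one_le_two).trans_eq ?_
  rw [eLpNorm_const_smul]
  rfl

end Convergence

variable {Ω : Set Plane}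

lemma inner_gradient_left (φ : Plane → ℝ) (x v : Plane) :
    inner ℝ v (gradient φ x) = fderiv ℝ φ x v := by
  rw [real_inner_comm]; simp [gradient]

/-- The test function is supported in $\Omega$, so both integrals extend to the whole plane, where
integration by parts in each direction $v$ has no boundary term. -/
lemma hasWeakGradient_of_contDiff {φ : Plane → ℝ} (hφ : ContDiff ℝ (⊤ : ℕ∞) φ) :
    HasWeakGradient Ω φ (gradient φ) := by
  intro ψ hψ hc hsupp
  have hgφ := continuous_gradient hφ
  have hgψ := continuous_gradient hψ
  have hψ0 : ∀ x, x ∉ Ω → ψ x = 0 := fun x hx => image_eq_zero_of_notMem_tsupport fun h => hx (hsupp h)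
  have hfψ : HasCompactSupport (fderiv ℝ ψ) := hc.fderiv ℝ
  have hcg : HasCompactSupport (gradient ψ) := hfψ.comp_left (map_zero _)
  have hgψ0 : ∀ x, x ∉ Ω → gradient ψ x = 0 := fun x hx => by
    have : fderiv ℝ ψ x = 0 := image_eq_zero_of_notMem_tsupport fun h =>
      hx (hsupp (tsupport_fderiv_subset ℝ h))
    simp [gradient, this]
  rw [setIntegral_eq_integral_of_forall_compl_eq_zero fun x hx => by simp [hgψ0 x hx],
    setIntegral_eq_integral_of_forall_compl_eq_zero fun x hx => by simp [hψ0 x hx]]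
  have hi1 : Integrable fun x => φ x • gradient ψ x :=
    (hφ.continuous.smul hgψ).integrable_of_hasCompactSupport (hcg.smul_left)
  have hi2 : Integrable fun x => ψ x • gradient φ x :=
    (hψ.continuous.smul hgφ).integrable_of_hasCompactSupport (hc.smul_right)
  refine ext_inner_left ℝ fun v => ?_
  rw [inner_neg_right, ← integral_inner hi1, ← integral_inner hi2]
  simp only [real_inner_smul_right, inner_gradient_left]
  have hcf : Continuous fun x => fderiv ℝ φ x v := (hφ.continuous_fderiv (by simp)).clm_apply continuous_const
  have hcf' : Continuous fun x => fderiv ℝ ψ x v := (hψ.continuous_fderiv (by simp)).clm_apply continuous_const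
  rw [integral_mul_fderiv_eq_neg_fderiv_mul_of_integrable]
  · simp only [mul_comm]
  · exact (hcf.mul hψ.continuous).integrable_of_hasCompactSupport hc.mul_left
  · exact (hφ.continuous.mul hcf').integrable_of_hasCompactSupport
      ((hc.fderiv_apply ℝ v).mul_left)
  · exact (hφ.continuous.mul hψ.continuous).integrable_of_hasCompactSupport hc.mul_left
  · exact fun x _ => hφ.differentiable (by simp) x
  · exact fun x _ => hψ.differentiable (by simp) x

/-- A limit of smooth functions in `H¹(Ω)` whose restrictions to the boundary converge has a
trace; that the limit of the gradients is a weak gradient is automatic. -/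
theorem HasTrace.of_tendsto {u g : Plane → ℝ} {G : Plane → Plane} (hu : MemLp u 2 (vol Ω))
    (hG : MemLp G 2 (vol Ω)) (hg : MemLp g 2 (arcLength Ω)) {φ : ℕ → Plane → ℝ}
    (hφ : ∀ n, ContDiff ℝ (⊤ : ℕ∞) (φ n))
    (h1 : Tendsto (fun n => eLpNorm (fun x => φ n x - u x) 2 (vol Ω)) atTop (𝓝 0))
    (h2 : Tendsto (fun n => eLpNorm (fun x => gradient (φ n) x - G x) 2 (vol Ω)) atTop (𝓝 0))
    (h3 : Tendsto (fun n => eLpNorm (fun x => φ n x - g x) 2 (arcLength Ω)) atTop (𝓝 0)) :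
    HasTrace Ω u G g := by
  refine ⟨⟨hu, hG, fun ψ hψ hc hsupp => ?_⟩, hg, φ, hφ, h1, h2, h3⟩
  have hcg : HasCompactSupport (gradient ψ) := (hc.fderiv ℝ).comp_left (map_zero _)
  have hψ2 : MemLp ψ 2 (vol Ω) := (hψ.continuous.memLp_of_hasCompactSupport hc).restrict Ω
  have hgψ2 : MemLp (gradient ψ) 2 (vol Ω) :=
    ((continuous_gradient hψ).memLp_of_hasCompactSupport hcg).restrict Ω
  have l1 := tendsto_integral_smul (fun n => (hφ n).continuous.aestronglyMeasurable) hu hgψ2 h1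
  have l2 := tendsto_integral_smul'
    (fun n => (continuous_gradient (hφ n)).aestronglyMeasurable) hG hψ2 h2
  refine tendsto_nhds_unique l1 (l2.neg.congr fun n => ?_)
  exact (hasWeakGradient_of_contDiff (hφ n) ψ hψ hc hsupp).symm

/-- The $\varepsilon$ form replaces diagonal sequences in closure arguments. -/
theorem hasTrace_iff_forall_exists {u g : Plane → ℝ} {G : Plane → Plane} :
    HasTrace Ω u G g ↔ MemLp u 2 (vol Ω) ∧ MemLp G 2 (vol Ω) ∧ MemLp g 2 (arcLength Ω) ∧
      ∀ ε : ℝ≥0∞, 0 < ε → ∃ φ : Plane → ℝ, ContDiff ℝ (⊤ : ℕ∞) φ ∧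
        eLpNorm (fun x => φ x - u x) 2 (vol Ω) < ε ∧
        eLpNorm (fun x => gradient φ x - G x) 2 (vol Ω) < ε ∧
        eLpNorm (fun x => φ x - g x) 2 (arcLength Ω) < ε := by
  constructor
  · rintro ⟨⟨hu, hG, -⟩, hg, φ, hφ, h1, h2, h3⟩
    refine ⟨hu, hG, hg, fun ε hε => ?_⟩
    obtain ⟨n, hn⟩ := ((h1.eventually_lt_const hε).and
      ((h2.eventually_lt_const hε).and (h3.eventually_lt_const hε))).exists
    exact ⟨φ n, hφ n, hn⟩
  · rintro ⟨hu, hG, hg, h⟩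
    choose φ hφ h1 h2 h3 using fun n : ℕ => h ((n : ℝ≥0∞) + 1)⁻¹ (by simp)
    have hlim : Tendsto (fun n : ℕ => ((n : ℝ≥0∞) + 1)⁻¹) atTop (𝓝 0) := by
      simpa [Function.comp_def] using
        ENNReal.tendsto_inv_nat_nhds_zero.comp (tendsto_add_atTop_nat 1)
    have squeeze {F : ℕ → ℝ≥0∞} (hF : ∀ n, F n < ((n : ℝ≥0∞) + 1)⁻¹) :
        Tendsto F atTop (𝓝 0) :=
      tendsto_of_tendsto_of_tendsto_of_le_of_le tendsto_const_nhds hlim (fun _ => zero_le)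
        fun n => (hF n).le
    exact HasTrace.of_tendsto hu hG hg hφ (squeeze h1) (squeeze h2) (squeeze h3)

lemma HasTrace.congr {u u' g : Plane → ℝ} {G G' : Plane → Plane} (h : HasTrace Ω u G g)
    (hu : u =ᵐ[vol Ω] u') (hG : G =ᵐ[vol Ω] G') : HasTrace Ω u' G' g := by
  rw [hasTrace_iff_forall_exists] at h ⊢
  refine ⟨h.1.ae_eq hu, h.2.1.ae_eq hG, h.2.2.1, fun ε hε => ?_⟩
  obtain ⟨φ, hφ, h1, h2, h3⟩ := h.2.2.2 ε hε
  refine ⟨φ, hφ, ?_, ?_, h3⟩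
  · rwa [eLpNorm_congr_ae (g := fun x => φ x - u x)
      (hu.mono fun x hx => by simp only [hx])]
  · rwa [eLpNorm_congr_ae (g := fun x => gradient φ x - G x)
      (hG.mono fun x hx => by simp only [hx])]

lemma gradient_add_smul {φ ψ : Plane → ℝ} (hφ : ContDiff ℝ (⊤ : ℕ∞) φ)
    (hψ : ContDiff ℝ (⊤ : ℕ∞) ψ) (c : ℝ) (x : Plane) :
    gradient (fun x => φ x + c • ψ x) x = gradient φ x + c • gradient ψ x := by
  have h1 := hφ.differentiable (by simp) x
  have h2 := hψ.differentiable (by simp) x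
  rw [gradient, fderiv_fun_add h1 (h2.fun_const_smul c), fderiv_fun_const_smul h2]
  simp [gradient]

lemma HasTrace.add_smul {u u' g g' : Plane → ℝ} {G G' : Plane → Plane} (h : HasTrace Ω u G g)
    (h' : HasTrace Ω u' G' g') (c : ℝ) :
    HasTrace Ω (fun x => u x + c • u' x) (fun x => G x + c • G' x)
      (fun x => g x + c • g' x) := by
  obtain ⟨⟨hu, hG, -⟩, hg, φ, hφ, h1, h2, h3⟩ := h
  obtain ⟨⟨hu', hG', -⟩, hg', ψ, hψ, h1', h2', h3'⟩ := h'
  refine HasTrace.of_tendsto (φ := fun n x => φ n x + c • ψ n x) (hu.add (hu'.const_smul c))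
    (hG.add (hG'.const_smul c)) (hg.add (hg'.const_smul c))
    (fun n => (hφ n).add ((hψ n).const_smul c)) ?_ ?_ ?_
  · exact tendsto_eLpNorm_add_smul c (fun n => (hφ n).continuous.aestronglyMeasurable)
      (fun n => (hψ n).continuous.aestronglyMeasurable) hu.1 hu'.1 h1 h1'
  · simp only [gradient_add_smul (hφ _) (hψ _)]
    exact tendsto_eLpNorm_add_smul c
      (fun n => (continuous_gradient (hφ n)).aestronglyMeasurable)
      (fun n => (continuous_gradient (hψ n)).aestronglyMeasurable) hG.1 hG'.1 h2 h2'
  · exact tendsto_eLpNorm_add_smul c (fun n => (hφ n).continuous.aestronglyMeasurable)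
      (fun n => (hψ n).continuous.aestronglyMeasurable) hg.1 hg'.1 h3 h3'

lemma HasTrace.sub {u u' g : Plane → ℝ} {G G' : Plane → Plane} (h : HasTrace Ω u G g)
    (h' : HasTrace Ω u' G' g) : HasTrace Ω (u - u') (G - G') (fun _ => 0) := by
  convert h.add_smul h' (-1) using 1 <;> ext x <;> simp [sub_eq_add_neg]

lemma hasTrace_zero : HasTrace Ω 0 0 (fun _ => 0) :=
  HasTrace.of_tendsto (φ := fun _ _ => 0) MemLp.zero MemLp.zero MemLp.zero
    (fun _ => contDiff_const) (by simp) (by simp [gradient]) (by simp)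

/-- The Poincaré inequality for functions with vanishing trace. -/
theorem exists_eLpNorm_le_of_hasTrace_zero (ho : IsOpen Ω) (hb : Bornology.IsBounded Ω) :
    ∃ C : ℝ≥0, ∀ (w : Plane → ℝ) (W : Plane → Plane), HasTrace Ω w W (fun _ => 0) →
      eLpNorm w 2 (vol Ω) ≤ C * eLpNorm W 2 (vol Ω) := by
  obtain ⟨C, hC, hP⟩ := exists_eLpNorm_le_gradient_add_boundary ho hb
  lift C to ℝ≥0 using hC
  refine ⟨C, fun w W h => ?_⟩
  obtain ⟨⟨hw, hW, -⟩, -, φ, hφ, h1, h2, h3⟩ := h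
  -- The smooth inequality is applied to the approximants. In the limit their distance to $w$ and
  -- $W$ and their boundary norm vanish.
  have hle : ∀ n, eLpNorm w 2 (vol Ω) ≤ eLpNorm (fun x => φ n x - w x) 2 (vol Ω) +
      C * ((eLpNorm (fun x => gradient (φ n) x - W x) 2 (vol Ω) + eLpNorm W 2 (vol Ω)) +
        eLpNorm (fun x => φ n x - 0) 2 (arcLength Ω)) := by
    intro n
    have hm := (hφ n).continuous.aestronglyMeasurable (μ := vol Ω)
    have hgm := (continuous_gradient (hφ n)).aestronglyMeasurable (μ := vol Ω)
    have e1 := eLpNorm_sub_le hm (hm.sub hw.1) one_le_two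
    have e2 := eLpNorm_add_le (hgm.sub hW.1) hW.1 one_le_two
    simp only [sub_sub_cancel, sub_add_cancel] at e1 e2
    calc _ ≤ _ := e1
      _ ≤ _ := by
        rw [add_comm]
        refine add_le_add le_rfl ((hP (φ n) (hφ n)).trans ?_)
        simp only [sub_zero]
        gcongr
        exact e2
  have := h1.add (ENNReal.Tendsto.const_mul ((h2.add_const (eLpNorm W 2 (vol Ω))).add h3)
    (Or.inr (ENNReal.coe_ne_top (r := C))))
  simpa using ge_of_tendsto' this hle

/-- The pairs of a function with vanishing trace and its weak gradient, in `L² × L²`. -/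
def zeroTrace (Ω : Set Plane) : Submodule ℝ (Lp ℝ 2 (vol Ω) × Lp Plane 2 (vol Ω)) where
  carrier := {p | HasTrace Ω p.1 p.2 (fun _ => 0)}
  zero_mem' := hasTrace_zero.congr (Lp.coeFn_zero _ _ _).symm (Lp.coeFn_zero _ _ _).symm
  add_mem' {p q} hp hq := by
    have h := HasTrace.add_smul hp hq 1
    simp only [one_smul, add_zero] at h
    exact h.congr (Lp.coeFn_add _ _).symm (Lp.coeFn_add _ _).symm
  smul_mem' c p hp := by
    have h := hasTrace_zero.add_smul hp c
    simp only [Pi.zero_apply, zero_add, smul_zero] at h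
    exact h.congr (Lp.coeFn_smul c p.1).symm (Lp.coeFn_smul c p.2).symm

/-- A smooth function that approximates a nearby pair within $\varepsilon/2$ approximates the limit
pair within $\varepsilon$; the boundary value is $0$ for both. -/
lemma isClosed_zeroTrace : IsClosed (zeroTrace Ω : Set (Lp ℝ 2 (vol Ω) × Lp Plane 2 (vol Ω))) := by
  refine isClosed_of_closure_subset fun p hp => ?_
  refine hasTrace_iff_forall_exists.2 ⟨Lp.memLp _, Lp.memLp _, MemLp.zero, fun ε hε => ?_⟩
  have hε2 : 0 < ε / 2 := ENNReal.half_pos hε.ne'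
  obtain ⟨q, hq, hpq⟩ := EMetric.mem_closure_iff.1 hp (ε / 2) hε2
  obtain ⟨-, -, -, h⟩ := hasTrace_iff_forall_exists.1 hq
  obtain ⟨φ, hφ, h1, h2, h3⟩ := h (ε / 2) hε2
  rw [edist_comm, Prod.edist_eq, max_lt_iff, Lp.edist_def, Lp.edist_def] at hpq
  have hm := hφ.continuous.aestronglyMeasurable (μ := vol Ω)
  have hgm := (continuous_gradient hφ).aestronglyMeasurable (μ := vol Ω)
  have e1 := eLpNorm_add_le (hm.sub (Lp.aestronglyMeasurable q.1))
    ((Lp.aestronglyMeasurable q.1).sub (Lp.aestronglyMeasurable p.1)) one_le_two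
  have e2 := eLpNorm_add_le (hgm.sub (Lp.aestronglyMeasurable q.2))
    ((Lp.aestronglyMeasurable q.2).sub (Lp.aestronglyMeasurable p.2)) one_le_two
  simp only [sub_add_sub_cancel] at e1 e2
  refine ⟨φ, hφ, e1.trans_lt ?_, e2.trans_lt ?_, h3.trans_le ENNReal.half_le_self⟩
  · exact (ENNReal.add_lt_add h1 hpq.1).trans_eq (ENNReal.add_halves ε)
  · exact (ENNReal.add_lt_add h2 hpq.2).trans_eq (ENNReal.add_halves ε)

/-- The gradients of functions with vanishing trace, in `L²`. -/
def zeroTraceGradients (Ω : Set Plane) : Submodule ℝ (Lp Plane 2 (vol Ω)) :=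
  (zeroTrace Ω).map (LinearMap.snd ℝ _ _)

lemma mem_zeroTraceGradients {V : Lp Plane 2 (vol Ω)} :
    V ∈ zeroTraceGradients Ω ↔ ∃ w, HasTrace Ω w V (fun _ => 0) := by
  constructor
  · rintro ⟨p, hp, rfl⟩
    exact ⟨_, hp⟩
  · rintro ⟨w, hw⟩
    exact ⟨(hw.memH1.memLp.toLp w, V), hw.congr hw.memH1.memLp.coeFn_toLp.symm .rfl, rfl⟩

/-- By Poincaré the projection $(w,W)\mapsto W$ is bounded below on the complete space `zeroTrace
Ω`, so its range is closed. -/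
lemma isClosed_zeroTraceGradients (ho : IsOpen Ω) (hb : Bornology.IsBounded Ω) :
    IsClosed (zeroTraceGradients Ω : Set (Lp Plane 2 (vol Ω))) := by
  obtain ⟨C, hC⟩ := exists_eLpNorm_le_of_hasTrace_zero ho hb
  have : CompleteSpace (zeroTrace Ω) := isClosed_zeroTrace.completeSpace_coe
  let f : zeroTrace Ω →L[ℝ] Lp Plane 2 (vol Ω) :=
    (ContinuousLinearMap.snd ℝ _ _).comp (zeroTrace Ω).subtypeL
  have hf : AntilipschitzWith (max C 1) f := by
    refine f.antilipschitz_of_bound fun p => ?_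
    have h1 : ‖(p : Lp ℝ 2 (vol Ω) × Lp Plane 2 (vol Ω)).1‖ ≤ C * ‖p.1.2‖ := by
      rw [Lp.norm_def, Lp.norm_def, ← ENNReal.coe_toReal C, ← ENNReal.toReal_mul]
      exact ENNReal.toReal_mono (ENNReal.mul_ne_top ENNReal.coe_ne_top (Lp.eLpNorm_ne_top _))
        (hC _ _ p.2)
    have h2 : ‖p‖ = max ‖p.1.1‖ ‖p.1.2‖ := rfl
    rw [h2]
    refine max_le (h1.trans ?_) ?_
    · exact mul_le_mul_of_nonneg_right (by simp) (norm_nonneg _)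
    · exact le_mul_of_one_le_left (norm_nonneg _) (by simp)
  have hr := hf.isClosed_range f.uniformContinuous
  convert hr
  ext V
  simp [zeroTraceGradients, f]

end Trace

section WeakSolution

/-! ### Coercive problems on a closed subspace -/

section Hilbert

variable {H : Type*} [NormedAddCommGroup H] [InnerProductSpace ℝ H]

/-- Lax–Milgram on an affine subspace `U + N`. -/
theorem exists_sub_mem_forall_inner_eq_zero [CompleteSpace H] (N : Submodule ℝ H) (hN : IsClosed (N : Set H))
    (A : H →L[ℝ] H) {a : ℝ} (ha : 0 < a) (hA : ∀ v, a * ‖v‖ ^ 2 ≤ inner ℝ (A v) v) (U : H) :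
    ∃ V : H, V - U ∈ N ∧ ∀ W ∈ N, inner ℝ (A V) W = 0 := by
  have : CompleteSpace N := hN.completeSpace_coe
  let B : N →L[ℝ] N →L[ℝ] ℝ := (innerSL ℝ).comp (N.orthogonalProjectionOnto.comp (A.comp N.subtypeL))
  have hB : ∀ v w : N, B v w = inner ℝ (A v) (w : H) := fun v w => by
    simp [B]
  have hc : IsCoercive B := ⟨a, ha, fun v => by
    rw [hB]; simpa [pow_two, mul_assoc] using hA v⟩
  -- The correction $v\in N$ solves $\langle Av,W\rangle=-\langle AU,W\rangle$ for all $W\in N$.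
  let v : N := -hc.continuousLinearEquivOfBilin.symm (N.orthogonalProjectionOnto (A U))
  refine ⟨U + v, by simp, fun W hW => ?_⟩
  have h1 := hc.continuousLinearEquivOfBilin_apply v ⟨W, hW⟩
  rw [hB] at h1
  simp only [v, map_neg, ContinuousLinearEquiv.apply_symm_apply, inner_neg_left] at h1
  rw [map_add, inner_add_left, ← h1]
  simp

/-- Energy estimate: testing with $V-U$ gives $\langle AV,V\rangle=\langle AV,U\rangle$. -/
lemma norm_le_of_forall_inner_eq_zero {N : Submodule ℝ H} {A : H →L[ℝ] H} {a b : ℝ}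
    (hA : ∀ v, a * ‖v‖ ^ 2 ≤ inner ℝ (A v) v) (hb : ∀ v, ‖A v‖ ≤ b * ‖v‖) {U V : H}
    (hV : V - U ∈ N) (h : ∀ W ∈ N, inner ℝ (A V) W = 0) : a * ‖V‖ ≤ b * ‖U‖ := by
  have h1 : a * ‖V‖ ^ 2 ≤ b * ‖V‖ * ‖U‖ :=
    calc a * ‖V‖ ^ 2 ≤ inner ℝ (A V) V := hA V
      _ = inner ℝ (A V) U := by
        have := h _ hV
        rwa [inner_sub_right, sub_eq_zero] at this
      _ ≤ ‖A V‖ * ‖U‖ := real_inner_le_norm _ _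
      _ ≤ b * ‖V‖ * ‖U‖ := by gcongr; exact hb V
  rcases (norm_nonneg V).eq_or_lt with h0 | h0
  · have : 0 ≤ b * ‖U‖ := (norm_nonneg _).trans (hb U)
    simpa [← h0] using this
  · refine le_of_mul_le_mul_right ?_ h0
    linarith

/-- Both equations are tested with $V-W\in N$, so that $\langle A(V-W),V-W\rangle=-\langle
(A-B)W,V-W\rangle$. Applied with $A=B$ it yields uniqueness. -/
lemma norm_sub_le_of_forall_inner_eq_zero {N : Submodule ℝ H} {A B : H →L[ℝ] H} {a : ℝ}
    (hA : ∀ v, a * ‖v‖ ^ 2 ≤ inner ℝ (A v) v) {U V W : H} (hV : V - U ∈ N) (hW : W - U ∈ N)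
    (h : ∀ Z ∈ N, inner ℝ (A V) Z = 0) (h' : ∀ Z ∈ N, inner ℝ (B W) Z = 0) :
    a * ‖V - W‖ ≤ ‖(A - B) W‖ := by
  have hD : V - W ∈ N := by simpa using N.sub_mem hV hW
  have h1 : a * ‖V - W‖ ^ 2 ≤ ‖(A - B) W‖ * ‖V - W‖ :=
    calc a * ‖V - W‖ ^ 2 ≤ inner ℝ (A (V - W)) (V - W) := hA _
      _ = -inner ℝ ((A - B) W) (V - W) := by
        rw [_root_.sub_apply, map_sub, inner_sub_left, inner_sub_left, h _ hD,
          h' _ hD]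
        ring
      _ ≤ ‖(A - B) W‖ * ‖V - W‖ := (neg_le_abs _).trans (abs_real_inner_le_norm _ _)
  rcases (norm_nonneg (V - W)).eq_or_lt with h0 | h0
  · simp [← h0]
  · refine le_of_mul_le_mul_right ?_ h0
    linarith

end Hilbert

/-! ### Multiplication by a conductivity -/

section Mul

variable {α : Type*} [MeasurableSpace α] {μ : Measure α}

lemma integral_abs_inner_le (V W : Lp Plane 2 μ) :
    ∫ x, |inner ℝ (V x) (W x)| ∂μ ≤ ‖V‖ * ‖W‖ := by
  have hV := (Lp.memLp V).norm
  have hW := (Lp.memLp W).norm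
  have h1 : inner ℝ (hV.toLp _) (hW.toLp _) = ∫ x, ‖V x‖ * ‖W x‖ ∂μ := by
    rw [L2.inner_def]
    refine integral_congr_ae ?_
    filter_upwards [hV.coeFn_toLp, hW.coeFn_toLp] with x h1 h2
    rw [h1, h2]
    simp [mul_comm]
  have h2 := real_inner_le_norm (hV.toLp _) (hW.toLp _)
  rw [h1, Lp.norm_toLp, Lp.norm_toLp, eLpNorm_norm, eLpNorm_norm] at h2
  refine (integral_mono_ae (L2.integrable_inner (𝕜 := ℝ) V W).abs
    (memLp_one_iff_integrable.1 (hW.mul (p := 2) (q := 2) (r := 1) hV)) ?_).trans h2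
  exact .of_forall fun x => abs_real_inner_le_norm _ _

/-- Multiplication by an `L^∞` function, on `L²`. -/
def mulL : Lp ℝ ∞ μ →L[ℝ] Lp Plane 2 μ →L[ℝ] Lp Plane 2 μ :=
  (ContinuousLinearMap.lsmul ℝ ℝ : ℝ →L[ℝ] Plane →L[ℝ] Plane).holderL μ ∞ 2 2

lemma coeFn_mulL (σ : Lp ℝ ∞ μ) (V : Lp Plane 2 μ) :
    mulL σ V =ᵐ[μ] fun x => σ x • V x := Lp.coeFn_lpSMul (r := 2) σ V

lemma norm_mulL_le (σ : Lp ℝ ∞ μ) (V : Lp Plane 2 μ) : ‖mulL σ V‖ ≤ ‖σ‖ * ‖V‖ :=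
  Lp.norm_smul_le σ V

lemma inner_mulL_eq_integral (σ : Lp ℝ ∞ μ) (V W : Lp Plane 2 μ) :
    inner ℝ (mulL σ V) W = ∫ x, σ x * inner ℝ (V x) (W x) ∂μ := by
  rw [L2.inner_def]
  refine integral_congr_ae ?_
  filter_upwards [coeFn_mulL σ V] with x hx
  rw [hx]
  simp [real_inner_smul_left]

lemma le_inner_mulL_self {σ : Lp ℝ ∞ μ} {a : ℝ} (h : ∀ᵐ x ∂μ, a ≤ σ x) (V : Lp Plane 2 μ) :
    a * ‖V‖ ^ 2 ≤ inner ℝ (mulL σ V) V := by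
  have h1 : a * ‖V‖ ^ 2 = ∫ x, a * inner ℝ (V x) (V x) ∂μ := by
    rw [integral_const_mul, ← L2.inner_def, real_inner_self_eq_norm_sq]
  have h2 : Integrable (fun x => σ x * inner ℝ (V x) (V x)) μ := by
    refine (L2.integrable_inner (𝕜 := ℝ) (mulL σ V) V).congr ?_
    filter_upwards [coeFn_mulL σ V] with x hx
    rw [hx]
    simp [real_inner_smul_left]
  rw [h1, inner_mulL_eq_integral]
  refine integral_mono_ae ((L2.integrable_inner (𝕜 := ℝ) V V).const_mul a) h2 ?_
  filter_upwards [h] with x hx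
  exact mul_le_mul_of_nonneg_right hx real_inner_self_nonneg

end Mul

/-! ### Weak solutions -/

variable {Ω : Set Plane} {g : Plane → ℝ}

lemma IsLipschitzDomain.isFiniteMeasure (hΩ : IsLipschitzDomain Ω) : IsFiniteMeasure (vol Ω) :=
  ⟨by simpa using hΩ.isBounded.measure_lt_top⟩

/-- Turns the weak equation into orthogonality in $L^2$, the form in which the Hilbert space lemmas
apply. -/
lemma isWeakSolution_iff {σ : Lp ℝ ∞ (vol Ω)} {u : Plane → ℝ} {G : Plane → Plane}
    (hG : MemLp G 2 (vol Ω)) :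
    IsWeakSolution Ω σ g u G ↔ HasTrace Ω u G g ∧
      ∀ W ∈ zeroTraceGradients Ω, inner ℝ (mulL σ (hG.toLp G)) W = 0 := by
  have key (W : Lp Plane 2 (vol Ω)) (W' : Plane → Plane) (h : W =ᵐ[vol Ω] W') :
      inner ℝ (mulL σ (hG.toLp G)) W = ∫ x in Ω, σ x * inner ℝ (G x) (W' x) := by
    rw [inner_mulL_eq_integral]
    refine integral_congr_ae ?_
    filter_upwards [hG.coeFn_toLp, h] with x h1 h2
    rw [h1, h2]
  constructor
  · rintro ⟨ht, hw⟩
    refine ⟨ht, fun W hW => ?_⟩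
    obtain ⟨w, hw'⟩ := mem_zeroTraceGradients.1 hW
    rw [key W W .rfl]
    exact hw w W hw'
  · rintro ⟨ht, hw⟩
    refine ⟨ht, fun w W hW => ?_⟩
    rw [← key _ W hW.memH1.memLp_grad.coeFn_toLp]
    exact hw _ (mem_zeroTraceGradients.2 ⟨w, hW.congr .rfl hW.memH1.memLp_grad.coeFn_toLp.symm⟩)

lemma exists_isWeakSolution (hΩ : IsLipschitzDomain Ω) (hg : MemHHalf Ω g) {σ : Lp ℝ ∞ (vol Ω)}
    {a : ℝ} (ha : 0 < a) (hσ : ∀ᵐ x ∂(vol Ω), a ≤ σ x) : ∃ u G, IsWeakSolution Ω σ g u G := by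
  obtain ⟨u, G, h⟩ := hg
  have hG := h.memH1.memLp_grad
  obtain ⟨V, hV, hV'⟩ := exists_sub_mem_forall_inner_eq_zero (zeroTraceGradients Ω)
    (isClosed_zeroTraceGradients hΩ.isOpen hΩ.isBounded) (mulL σ) ha
    (le_inner_mulL_self hσ) (hG.toLp G)
  obtain ⟨w, hw⟩ := mem_zeroTraceGradients.1 hV
  have ht := h.add_smul hw 1
  simp only [one_smul, add_zero] at ht
  refine ⟨_, V, (isWeakSolution_iff (Lp.memLp V)).2
    ⟨ht.congr .rfl ?_, by simpa only [Lp.toLp_coeFn] using hV'⟩⟩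
  filter_upwards [Lp.coeFn_sub V (hG.toLp G), hG.coeFn_toLp] with x h1 h2
  rw [h1, Pi.sub_apply, h2, add_sub_cancel]

lemma gradPotential_spec (hΩ : IsLipschitzDomain Ω) (hg : MemHHalf Ω g) {σ : Lp ℝ ∞ (vol Ω)}
    {a : ℝ} (ha : 0 < a) (hσ : ∀ᵐ x ∂(vol Ω), a ≤ σ x) :
    ∃ u, IsWeakSolution Ω σ g u (gradPotential Ω σ g) := by
  obtain ⟨u, G, h⟩ := exists_isWeakSolution hΩ hg ha hσ
  exact Classical.epsilon_spec (p := fun G => ∃ u, IsWeakSolution Ω σ g u G) ⟨G, u, h⟩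

/-- The stability estimate with equal conductivities identifies the gradients; Poincaré for the
zero-trace difference then identifies the functions. -/
lemma IsWeakSolution.ae_unique (hΩ : IsLipschitzDomain Ω) {σ : Lp ℝ ∞ (vol Ω)}
    {a : ℝ} (ha : 0 < a) (hσ : ∀ᵐ x ∂(vol Ω), a ≤ σ x) {u u' : Plane → ℝ} {G G' : Plane → Plane}
    (h : IsWeakSolution Ω σ g u G) (h' : IsWeakSolution Ω σ g u' G') :
    u =ᵐ[vol Ω] u' ∧ G =ᵐ[vol Ω] G' := by
  have hG := h.trace.memH1.memLp_grad
  have hG' := h'.trace.memH1.memLp_grad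
  have ht := h.trace.sub h'.trace
  have hGG : G =ᵐ[vol Ω] G' := by
    rw [← MemLp.toLp_eq_toLp_iff hG hG', ← sub_eq_zero, ← norm_eq_zero]
    have hmem : hG.toLp G - hG'.toLp G' ∈ zeroTraceGradients Ω := by
      rw [← MemLp.toLp_sub]
      exact mem_zeroTraceGradients.2 ⟨_, ht.congr .rfl (MemLp.coeFn_toLp _).symm⟩
    have := norm_sub_le_of_forall_inner_eq_zero (U := hG'.toLp G') (le_inner_mulL_self hσ) hmem
      (by simp) ((isWeakSolution_iff hG).1 h).2 ((isWeakSolution_iff hG').1 h').2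
    rw [sub_self, _root_.zero_apply, norm_zero] at this
    exact le_antisymm (nonpos_of_mul_nonpos_right this ha) (norm_nonneg _)
  refine ⟨?_, hGG⟩
  obtain ⟨C, hC⟩ := exists_eLpNorm_le_of_hasTrace_zero hΩ.isOpen hΩ.isBounded
  have h0 : eLpNorm (G - G') 2 (vol Ω) = 0 := by
    rw [eLpNorm_eq_zero_iff (hG.sub hG').1 two_ne_zero]
    filter_upwards [hGG] with x hx
    simp [hx]
  have h1 := hC _ _ ht
  rw [h0, mul_zero, nonpos_iff_eq_zero, eLpNorm_eq_zero_iff ht.memH1.memLp.1 two_ne_zero] at h1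
  filter_upwards [h1] with x hx
  simpa [sub_eq_zero] using hx

/-- The gradients of the potentials as elements of `L²`: they lie in one affine subspace, and
solve the variational equation. -/
lemma exists_gradPotential_eq (hΩ : IsLipschitzDomain Ω) (hg : MemHHalf Ω g) :
    ∃ U : Lp Plane 2 (vol Ω), ∀ (σ : Lp ℝ ∞ (vol Ω)) (a : ℝ), 0 < a →
      (∀ᵐ x ∂(vol Ω), a ≤ σ x) → ∃ P : Lp Plane 2 (vol Ω), P =ᵐ[vol Ω] gradPotential Ω σ g ∧
        P - U ∈ zeroTraceGradients Ω ∧ ∀ W ∈ zeroTraceGradients Ω, inner ℝ (mulL σ P) W = 0 := by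
  obtain ⟨u₀, G₀, h₀⟩ := id hg
  have hG₀ := h₀.memH1.memLp_grad
  refine ⟨hG₀.toLp G₀, fun σ a ha hσ => ?_⟩
  obtain ⟨u, h⟩ := gradPotential_spec hΩ hg ha hσ
  have hP := h.trace.memH1.memLp_grad
  refine ⟨hP.toLp _, hP.coeFn_toLp, ?_, ((isWeakSolution_iff hP).1 h).2⟩
  rw [← MemLp.toLp_sub]
  exact mem_zeroTraceGradients.2
    ⟨_, (h.trace.sub h₀).congr .rfl (MemLp.coeFn_toLp _).symm⟩

end WeakSolution

section Likelihood

/-! ### Power densities -/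

lemma ae_abs_le_norm {α : Type*} [MeasurableSpace α] {μ : Measure α} (f : Lp ℝ ∞ μ) :
    ∀ᵐ x ∂μ, |f x| ≤ ‖f‖ := by
  filter_upwards [ae_le_eLpNormEssSup (f := f) (μ := μ)] with x hx
  rw [← eLpNorm_exponent_top, ← Lp.enorm_def, enorm_le_iff_norm_le] at hx
  exact hx

lemma norm_le_of_ae_abs_le {α : Type*} [MeasurableSpace α] {μ : Measure α} [IsFiniteMeasure μ]
    {f : Lp ℝ ∞ μ} {b : ℝ} (hb : 0 ≤ b) (h : ∀ᵐ x ∂μ, |f x| ≤ b) : ‖f‖ ≤ b := by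
  simpa using Lp.norm_le_of_ae_bound (f := f) hb h

variable {Ω : Set Plane} {d : ℕ} {g : Fin d → Plane → ℝ}

/-- The power densities in terms of the gradients, as elements of `L²`. -/
lemma powerDensity_ae_eq {σ : Conductivity Ω} {i j : Fin d} {P Q : Lp Plane 2 (vol Ω)}
    (hP : P =ᵐ[vol Ω] gradPotential Ω σ.1 (g i)) (hQ : Q =ᵐ[vol Ω] gradPotential Ω σ.1 (g j)) :
    powerDensity g σ i j =ᵐ[vol Ω] fun x => inner ℝ (mulL σ.1 P x) (Q x) := by
  filter_upwards [hP, hQ, coeFn_mulL σ.1 P] with x h1 h2 h3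
  rw [h3, real_inner_smul_left, h1, h2, powerDensity]

theorem integrable_powerDensity (hΩ : IsLipschitzDomain Ω) (hg : ∀ i, MemHHalf Ω (g i))
    (σ : Conductivity Ω) (i j : Fin d) : Integrable (powerDensity g σ i j) (vol Ω) := by
  obtain ⟨a, b, ha, hab⟩ := σ.2
  have hσ : ∀ᵐ x ∂(vol Ω), a ≤ σ.1 x := hab.mono fun x hx => hx.1.le
  obtain ⟨U, hU⟩ := exists_gradPotential_eq hΩ (hg i)
  obtain ⟨V, hV⟩ := exists_gradPotential_eq hΩ (hg j)
  obtain ⟨P, hP, -⟩ := hU σ.1 a ha hσ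
  obtain ⟨Q, hQ, -⟩ := hV σ.1 a ha hσ
  exact (L2.integrable_inner (𝕜 := ℝ) _ _).congr (powerDensity_ae_eq hP hQ).symm

/-- The reference gradients $U$, $V$ do not depend on $\sigma$, so the energy and stability
estimates are uniform over the bounded class; the product is then telescoped. -/
theorem exists_integral_abs_powerDensity_sub_le (hΩ : IsLipschitzDomain Ω)
    (hg : ∀ i, MemHHalf Ω (g i)) {a b : ℝ} (ha : 0 < a) (hb : 0 ≤ b) (i j : Fin d) :
    ∃ C : ℝ, 0 ≤ C ∧ ∀ σ₁ ∈ boundedBy Ω a b, ∀ σ₂ ∈ boundedBy Ω a b,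
      ∫ x in Ω, |powerDensity g σ₁ i j x - powerDensity g σ₂ i j x| ≤ C * ‖σ₁.1 - σ₂.1‖ := by
  have := hΩ.isFiniteMeasure
  obtain ⟨U, hU⟩ := exists_gradPotential_eq hΩ (hg i)
  obtain ⟨V, hV⟩ := exists_gradPotential_eq hΩ (hg j)
  have hlow {σ : Conductivity Ω} (h : σ ∈ boundedBy Ω a b) : ∀ᵐ x ∂(vol Ω), a ≤ σ.1 x :=
    (show ∀ᵐ x ∂(vol Ω), a < σ.1 x ∧ σ.1 x < b from h).mono fun x hx => hx.1.le
  have hnorm {σ : Conductivity Ω} (h : σ ∈ boundedBy Ω a b) : ‖σ.1‖ ≤ b :=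
    norm_le_of_ae_abs_le hb <| (show ∀ᵐ x ∂(vol Ω), a < σ.1 x ∧ σ.1 x < b from h).mono fun x hx => by
      rw [abs_of_pos (ha.trans hx.1)]; exact hx.2.le
  have hsol {σ : Conductivity Ω} (h : σ ∈ boundedBy Ω a b) {U P : Lp Plane 2 (vol Ω)}
      (h1 : P - U ∈ zeroTraceGradients Ω)
      (h2 : ∀ W ∈ zeroTraceGradients Ω, inner ℝ (mulL σ.1 P) W = 0) : ‖P‖ ≤ b / a * ‖U‖ := by
    have := norm_le_of_forall_inner_eq_zero (b := b) (le_inner_mulL_self (hlow h))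
      (fun v => (norm_mulL_le _ v).trans
        (mul_le_mul_of_nonneg_right (hnorm h) (norm_nonneg v))) h1 h2
    rw [div_mul_eq_mul_div, le_div_iff₀ ha]
    linarith
  have hdiff {σ₁ σ₂ : Conductivity Ω} (hσ₁ : σ₁ ∈ boundedBy Ω a b) (hσ₂ : σ₂ ∈ boundedBy Ω a b)
      {U P₁ P₂ : Lp Plane 2 (vol Ω)} (h1 : P₁ - U ∈ zeroTraceGradients Ω)
      (h1' : P₂ - U ∈ zeroTraceGradients Ω)
      (h2 : ∀ W ∈ zeroTraceGradients Ω, inner ℝ (mulL σ₁.1 P₁) W = 0)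
      (h2' : ∀ W ∈ zeroTraceGradients Ω, inner ℝ (mulL σ₂.1 P₂) W = 0) :
      ‖P₁ - P₂‖ ≤ b / a ^ 2 * ‖U‖ * ‖σ₁.1 - σ₂.1‖ := by
    have h := norm_sub_le_of_forall_inner_eq_zero (le_inner_mulL_self (hlow hσ₁)) h1 h1' h2 h2'
    rw [← map_sub] at h
    have h' : a * ‖P₁ - P₂‖ ≤ ‖σ₁.1 - σ₂.1‖ * (b / a * ‖U‖) :=
      (h.trans (norm_mulL_le _ _)).trans
        (mul_le_mul_of_nonneg_left (hsol hσ₂ h1' h2') (norm_nonneg _))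
    refine le_of_mul_le_mul_left (h'.trans_eq ?_) ha
    field_simp
  set M := b / a * ‖U‖
  set M' := b / a * ‖V‖
  set D := b / a ^ 2 * ‖U‖
  set D' := b / a ^ 2 * ‖V‖
  refine ⟨(M + b * D) * M' + b * M * D', by positivity, fun σ₁ hσ₁ σ₂ hσ₂ => ?_⟩
  obtain ⟨P₁, hP₁, hP₁U, hP₁'⟩ := hU σ₁.1 a ha (hlow hσ₁)
  obtain ⟨P₂, hP₂, hP₂U, hP₂'⟩ := hU σ₂.1 a ha (hlow hσ₂)
  obtain ⟨Q₁, hQ₁, hQ₁V, hQ₁'⟩ := hV σ₁.1 a ha (hlow hσ₁)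
  obtain ⟨Q₂, hQ₂, hQ₂V, hQ₂'⟩ := hV σ₂.1 a ha (hlow hσ₂)
  set δ := ‖σ₁.1 - σ₂.1‖
  -- Telescoping: $\langle\sigma_1P_1,Q_1\rangle-\langle\sigma_2P_2,Q_2\rangle=\langle
  -- A,Q_1\rangle+\langle B,Q_1-Q_2\rangle$.
  set A := mulL σ₁.1 P₁ - mulL σ₂.1 P₂
  set B := mulL σ₂.1 P₂
  have hA : ‖A‖ ≤ (M + b * D) * δ := by
    have : A = mulL (σ₁.1 - σ₂.1) P₁ + mulL σ₂.1 (P₁ - P₂) := by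
      simp only [A, map_sub, _root_.sub_apply]; abel
    rw [this]
    calc _ ≤ δ * ‖P₁‖ + ‖σ₂.1‖ * ‖P₁ - P₂‖ :=
          (norm_add_le _ _).trans (add_le_add (norm_mulL_le _ _) (norm_mulL_le _ _))
      _ ≤ δ * M + b * (D * δ) := by
          gcongr
          · exact hsol hσ₁ hP₁U hP₁'
          · exact hnorm hσ₂
          · exact hdiff hσ₁ hσ₂ hP₁U hP₂U hP₁' hP₂'
      _ = _ := by ring
  have hB : ‖B‖ ≤ b * M := (norm_mulL_le _ _).trans
    (mul_le_mul (hnorm hσ₂) (hsol hσ₂ hP₂U hP₂') (norm_nonneg _) hb)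
  have hint (X Y : Lp Plane 2 (vol Ω)) : Integrable (fun x => |inner ℝ (X x) (Y x)|) (vol Ω) :=
    (L2.integrable_inner (𝕜 := ℝ) X Y).abs
  calc ∫ x in Ω, |powerDensity g σ₁ i j x - powerDensity g σ₂ i j x|
      ≤ ∫ x in Ω, (|inner ℝ (A x) (Q₁ x)| + |inner ℝ (B x) ((Q₁ - Q₂) x)|) := by
        refine integral_mono_ae ((integrable_powerDensity hΩ hg σ₁ i j).sub
          (integrable_powerDensity hΩ hg σ₂ i j)).abs ((hint _ _).add (hint _ _)) ?_
        filter_upwards [powerDensity_ae_eq hP₁ hQ₁, powerDensity_ae_eq hP₂ hQ₂,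
          Lp.coeFn_sub (mulL σ₁.1 P₁) (mulL σ₂.1 P₂), Lp.coeFn_sub Q₁ Q₂] with x h1 h2 h3 h4
        rw [h1, h2, h3, h4]
        refine le_trans (le_of_eq ?_) (abs_add_le _ _)
        simp only [Pi.sub_apply, inner_sub_left, inner_sub_right, B]
        ring_nf
    _ ≤ ‖A‖ * ‖Q₁‖ + ‖B‖ * ‖Q₁ - Q₂‖ := by
        rw [integral_add (hint _ _) (hint _ _)]
        exact add_le_add (integral_abs_inner_le _ _) (integral_abs_inner_le _ _)
    _ ≤ (M + b * D) * δ * M' + b * M * (D' * δ) := by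
        gcongr
        · exact hsol hσ₁ hQ₁V hQ₁'
        · exact hdiff hσ₁ hσ₂ hQ₁V hQ₂V hQ₁' hQ₂'
    _ = _ := by ring

/-! ### The negative log-likelihood -/

variable {τ : Fin d → Fin d → ℝ}

/-- Reverse triangle inequality in $L^1$, with data and conductivity both varying so that both
Lipschitz bounds are special cases. -/
lemma abs_negLogLikelihood_sub_le (hΩ : IsLipschitzDomain Ω) (hg : ∀ i, MemHHalf Ω (g i))
    (hτ : ∀ i j, 0 < τ i j) (y₁ y₂ : Data Ω d) (σ₁ σ₂ : Conductivity Ω) :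
    |negLogLikelihood g τ y₁ σ₁ - negLogLikelihood g τ y₂ σ₂| ≤
      ∑ i, ∑ j, ((∫ x in Ω, |powerDensity g σ₁ i j x - powerDensity g σ₂ i j x|) +
        ‖y₁ i j - y₂ i j‖) / τ i j := by
  simp only [negLogLikelihood, ← Finset.sum_sub_distrib]
  refine (Finset.abs_sum_le_sum_abs _ _).trans (Finset.sum_le_sum fun i _ =>
    (Finset.abs_sum_le_sum_abs _ _).trans (Finset.sum_le_sum fun j _ => ?_))
  rw [← sub_div, abs_div, abs_of_pos (hτ i j)]
  have h1 := integrable_powerDensity hΩ hg σ₁ i j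
  have h2 := integrable_powerDensity hΩ hg σ₂ i j
  have hy₁ := L1.integrable_coeFn (y₁ i j)
  have hy₂ := L1.integrable_coeFn (y₂ i j)
  have hy : ‖y₁ i j - y₂ i j‖ = ∫ x in Ω, |y₁ i j x - y₂ i j x| := by
    rw [L1.norm_eq_integral_norm]
    refine integral_congr_ae ?_
    filter_upwards [Lp.coeFn_sub (y₁ i j) (y₂ i j)] with x hx
    rw [hx, Pi.sub_apply, Real.norm_eq_abs]
  gcongr
  · exact (hτ i j).le
  have i1 : Integrable (fun x => |powerDensity g σ₁ i j x - y₁ i j x|) (vol Ω) := (h1.sub hy₁).abs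
  have i2 : Integrable (fun x => |powerDensity g σ₂ i j x - y₂ i j x|) (vol Ω) := (h2.sub hy₂).abs
  have i3 : Integrable (fun x => |powerDensity g σ₁ i j x - powerDensity g σ₂ i j x|) (vol Ω) :=
    (h1.sub h2).abs
  have i4 : Integrable (fun x => |y₁ i j x - y₂ i j x|) (vol Ω) := (hy₁.sub hy₂).abs
  rw [hy, ← integral_add i3 i4, ← integral_sub i1 i2]
  refine abs_integral_le_integral_abs.trans (integral_mono (i1.sub i2).abs (i3.add i4) fun x => ?_)
  refine (abs_abs_sub_abs_le_abs_sub _ _).trans ?_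
  rw [sub_sub_sub_comm]
  exact abs_sub _ _

theorem exists_abs_negLogLikelihood_sub_le_norm (hΩ : IsLipschitzDomain Ω)
    (hg : ∀ i, MemHHalf Ω (g i)) (hτ : ∀ i j, 0 < τ i j) {a b : ℝ} (ha : 0 < a) (hb : 0 ≤ b) :
    ∃ C : ℝ, 0 < C ∧ ∀ y : Data Ω d, ∀ σ₁ ∈ boundedBy Ω a b, ∀ σ₂ ∈ boundedBy Ω a b,
      |negLogLikelihood g τ y σ₁ - negLogLikelihood g τ y σ₂| ≤ C * ‖σ₁.1 - σ₂.1‖ := by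
  choose C hC0 hC using exists_integral_abs_powerDensity_sub_le (d := d) hΩ hg ha hb
  have h0 : 0 ≤ ∑ i, ∑ j, C i j / τ i j := Finset.sum_nonneg fun i _ =>
    Finset.sum_nonneg fun j _ => div_nonneg (hC0 i j) (hτ i j).le
  -- The added $1$ keeps the constant positive when the sum vanishes, for instance when $d=0$.
  refine ⟨∑ i, ∑ j, C i j / τ i j + 1, by positivity, fun y σ₁ h1 σ₂ h2 => ?_⟩
  refine (abs_negLogLikelihood_sub_le hΩ hg hτ y y σ₁ σ₂).trans ?_
  simp only [sub_self, norm_zero, add_zero]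
  rw [add_mul, Finset.sum_mul, one_mul]
  refine le_add_of_le_of_nonneg (Finset.sum_le_sum fun i _ => ?_) (norm_nonneg _)
  rw [Finset.sum_mul]
  refine Finset.sum_le_sum fun j _ => ?_
  rw [div_mul_eq_mul_div]
  exact div_le_div_of_nonneg_right (hC i j σ₁ h1 σ₂ h2) (hτ i j).le

theorem continuous_negLogLikelihood (hΩ : IsLipschitzDomain Ω) (hg : ∀ i, MemHHalf Ω (g i))
    (hτ : ∀ i j, 0 < τ i j) (y : Data Ω d) : Continuous (negLogLikelihood g τ y) := by
  refine continuous_iff_continuousAt.2 fun σ₀ => ?_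
  obtain ⟨a, b, ha, hab⟩ := σ₀.2
  -- An $L^\infty$ perturbation below $a/2$ keeps the values between $a/2$ and $|b|+a$. The absolute
  -- value is there because $b$ may be negative when $\Omega$ is null.
  have hb : 0 ≤ |b| + a := by positivity
  have hnear : ∀ σ : Conductivity Ω, dist σ σ₀ < a / 2 → σ ∈ boundedBy Ω (a / 2) (|b| + a) := by
    intro σ hσ
    rw [Subtype.dist_eq, dist_eq_norm] at hσ
    filter_upwards [hab, ae_abs_le_norm (σ.1 - σ₀.1), Lp.coeFn_sub σ.1 σ₀.1] with x h1 h2 h3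
    rw [h3, Pi.sub_apply] at h2
    have h4 := abs_le.1 (h2.trans hσ.le)
    have h5 := abs_lt.1 (h2.trans_lt hσ)
    have h6 := le_abs_self b
    constructor <;> linarith
  obtain ⟨C, -, hC⟩ := exists_abs_negLogLikelihood_sub_le_norm hΩ hg hτ (half_pos ha) hb
  refine continuousAt_of_locally_lipschitz (half_pos ha) C fun σ hσ => ?_
  rw [Real.dist_eq, Subtype.dist_eq, dist_eq_norm]
  exact hC y σ (hnear σ hσ) σ₀ (hnear σ₀ (by simpa using half_pos ha))

theorem exists_abs_negLogLikelihood_sub_le_data (hΩ : IsLipschitzDomain Ω)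
    (hg : ∀ i, MemHHalf Ω (g i)) (hτ : ∀ i j, 0 < τ i j) :
    ∃ C : ℝ, 0 < C ∧ ∀ (σ : Conductivity Ω) (y₁ y₂ : Data Ω d),
      |negLogLikelihood g τ y₁ σ - negLogLikelihood g τ y₂ σ| ≤
        C * ∑ i, ∑ j, ‖y₁ i j - y₂ i j‖ := by
  have hnn : ∀ i j, 0 ≤ 1 / τ i j := fun i j => (one_div_pos.2 (hτ i j)).le
  have h0 : 0 ≤ ∑ i, ∑ j, 1 / τ i j :=
    Finset.sum_nonneg fun i _ => Finset.sum_nonneg fun j _ => hnn i j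
  -- The sum dominates each single weight $1/\tau_{i,j}$, so the constant depends on the noise
  -- scales alone.
  refine ⟨∑ i, ∑ j, 1 / τ i j + 1, by positivity, fun σ y₁ y₂ => ?_⟩
  refine (abs_negLogLikelihood_sub_le hΩ hg hτ y₁ y₂ σ σ).trans ?_
  simp only [sub_self, abs_zero, integral_zero, zero_add, Finset.mul_sum]
  refine Finset.sum_le_sum fun i _ => Finset.sum_le_sum fun j _ => ?_
  rw [div_eq_mul_one_div, mul_comm]
  refine mul_le_mul_of_nonneg_right ?_ (norm_nonneg _)
  have h1 := Finset.single_le_sum (f := fun j => 1 / τ i j) (fun j _ => hnn i j)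
    (Finset.mem_univ j)
  have h2 := Finset.single_le_sum (f := fun i => ∑ j, 1 / τ i j)
    (fun i _ => Finset.sum_nonneg fun j _ => hnn i j) (Finset.mem_univ i)
  exact (h1.trans h2).trans (le_add_of_nonneg_right zero_le_one)

/-! ### From prior samples to conductivities -/

lemma IsPriorMap.measurable {F : ℝ → ℝ} (hF : IsPriorMap F) : Measurable F := by
  rcases hF with rfl | ⟨sp, sm, -, -, rfl⟩ | ⟨sp, sm, α, -, -, -, rfl⟩
  · exact Real.measurable_exp
  · exact ((measurable_one.indicator measurableSet_Ici).const_mul _).const_add _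
  · unfold sigmoidMap
    fun_prop

lemma exists_conductivity_ae_eq (hΩ : IsLipschitzDomain Ω) {f : Plane → ℝ}
    (hf : AEStronglyMeasurable f (vol Ω)) {a b : ℝ} (ha : 0 < a)
    (h : ∀ᵐ x ∂(vol Ω), a < f x ∧ f x < b) : ∃ σ : Conductivity Ω, σ.1 =ᵐ[vol Ω] f := by
  have := hΩ.isFiniteMeasure
  have hL : MemLp f ∞ (vol Ω) := MemLp.of_bound hf b <| h.mono fun x hx => by
    rw [Real.norm_of_nonneg (ha.trans hx.1).le]; exact hx.2.le
  refine ⟨⟨hL.toLp f, a, b, ha, ?_⟩, hL.coeFn_toLp⟩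
  filter_upwards [h, hL.coeFn_toLp] with x h1 h2
  rwa [h2]

end Likelihood

end AET

end

/-- Well-posedness of the `L¹` likelihood of acousto-electric tomography. The Gaussian prior `μ`
lives on a Hilbert space `𝕏` of functions on `Ω`: each `x : 𝕏` is a measurable function on `Ω` up
to equality almost everywhere, through the injective linear map `toFun`. The conductivity is
`F ∘ x`, so that "almost surely" for the prior on conductivities means for `μ`-almost every `x`. -/
theorem mainTheorem1
    (Ω : Set AET.Plane) (hΩ : AET.IsLipschitzDomain Ω)
    (d : ℕ) (g : Fin d → AET.Plane → ℝ) (hg : ∀ i, AET.MemHHalf Ω (g i))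
    (τ : Fin d → Fin d → ℝ) (hτ : ∀ i j, 0 < τ i j)
    {𝕏 : Type*} [NormedAddCommGroup 𝕏] [InnerProductSpace ℝ 𝕏] [CompleteSpace 𝕏]
    [MeasurableSpace 𝕏] [BorelSpace 𝕏]
    (toFun : 𝕏 →ₗ[ℝ] (AET.Plane →ₘ[AET.vol Ω] ℝ)) (htoFun : Function.Injective toFun)
    (μ : Measure 𝕏) [IsGaussian μ]
    (F : ℝ → ℝ) (hF : AET.IsPriorMap F)
    (hbounds : ∀ᵐ x ∂μ, ∃ σmin σmax : ℝ, 0 < σmin ∧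
      ∀ᵐ ξ ∂(AET.vol Ω), σmin < F (toFun x ξ) ∧ F (toFun x ξ) < σmax) :
    -- the forward map is well defined, with values in `L¹(Ω)`
    (∀ σ : AET.Conductivity Ω,
      (∀ i, ∃ u, AET.IsWeakSolution Ω σ.1 (g i) u (AET.gradPotential Ω σ.1 (g i))) ∧
      (∀ i u G u' G', AET.IsWeakSolution Ω σ.1 (g i) u G →
        AET.IsWeakSolution Ω σ.1 (g i) u' G' →
        u =ᵐ[AET.vol Ω] u' ∧ G =ᵐ[AET.vol Ω] G') ∧
      ∀ i j, Integrable (AET.powerDensity g σ i j) (AET.vol Ω)) ∧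
    -- (1) the likelihood is Borel measurable in the conductivity
    (∀ y : AET.Data Ω d,
      Measurable[borel (AET.Conductivity Ω), borel ℝ] (AET.likelihood g τ y)) ∧
    -- (2) almost sure continuity, and the Lipschitz bound in the `L^∞` norm
    (∀ y : AET.Data Ω d, ∀ᵐ x ∂μ, ∃ σ : AET.Conductivity Ω,
      (∀ᵐ ξ ∂(AET.vol Ω), σ.1 ξ = F (toFun x ξ)) ∧
      ContinuousAt (AET.negLogLikelihood g τ y) σ) ∧
    (∀ σmin σmax : ℝ, 0 < σmin → σmin < σmax → ∃ C : ℝ, 0 < C ∧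
      ∀ y : AET.Data Ω d, ∀ σ₁ ∈ AET.boundedBy Ω σmin σmax, ∀ σ₂ ∈ AET.boundedBy Ω σmin σmax,
        |AET.negLogLikelihood g τ y σ₁ - AET.negLogLikelihood g τ y σ₂| ≤ C * ‖σ₁.1 - σ₂.1‖) ∧
    -- (3) the Lipschitz bound in the data
    (∀ r σmax : ℝ, 0 < r → 0 < σmax → ∃ C : ℝ, 0 < C ∧
      ∀ σmin : ℝ, 0 < σmin → ∀ σ ∈ AET.boundedBy Ω σmin σmax, ∀ y₁ y₂ : AET.Data Ω d,
        (∀ i j, max ‖y₁ i j‖ ‖y₂ i j‖ < r) →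
        |AET.negLogLikelihood g τ y₁ σ - AET.negLogLikelihood g τ y₂ σ| ≤
          C * ∑ i, ∑ j, ‖y₁ i j - y₂ i j‖) := by
  refine ⟨fun σ => ?_, fun y => ?_, fun y => ?_, fun a b ha hab => ?_, fun r b _ _ => ?_⟩
  · obtain ⟨a, b, ha, hab⟩ := σ.2
    have hσ : ∀ᵐ ξ ∂(AET.vol Ω), a ≤ σ.1 ξ := hab.mono fun ξ hξ => hξ.1.le
    exact ⟨fun i => AET.gradPotential_spec hΩ (hg i) ha hσ,
      fun i u G u' G' h h' => h.ae_unique hΩ ha hσ h',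
      fun i j => AET.integrable_powerDensity hΩ hg σ i j⟩
  · exact (Real.continuous_exp.comp
      (AET.continuous_negLogLikelihood hΩ hg hτ y).neg).borel_measurable
  · filter_upwards [hbounds] with x ⟨a, b, ha, hab⟩
    -- Since $\Phi(y,\cdot)$ is continuous everywhere, it is enough to realise $F\circ x$ as an
    -- element of $L^\infty$ with the required bounds.
    obtain ⟨σ, hσ⟩ := AET.exists_conductivity_ae_eq hΩ
      (hF.measurable.comp_aemeasurable (toFun x).aestronglyMeasurable.aemeasurable
        ).aestronglyMeasurable ha hab
    exact ⟨σ, hσ, (AET.continuous_negLogLikelihood hΩ hg hτ y).continuousAt⟩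
  · exact AET.exists_abs_negLogLikelihood_sub_le_norm hΩ hg hτ ha (ha.trans hab).le
  · obtain ⟨C, hC, h⟩ := AET.exists_abs_negLogLikelihood_sub_le_data hΩ hg hτ
    exact ⟨C, hC, fun a _ σ _ y₁ y₂ _ => h σ y₁ y₂⟩
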